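/- **Setting.** Let $X$ be a CAT(0) cube complex and let $G$ be a group acting properly and cocompactly on $X$ by cubical automorphisms. A wall of $X$ is a connected component of the complex of midcubes of $X$; $W(e)$ is the wall crossed by the edge $e$, and $e$ is then called dual to $W(e)$. Let $N(W)$ be the union of the cubes meeting $W$. The two sides $W^+,W^-$ of a wall $W$ are the two classes of vertices of $N(W)$ under being joined by an edge path in $N(W)$ not crossing $W$; assume that they are labelled so that $gW^\pm=(gW)^\pm$ for all $g\in G$. Let $K\lhd G$ act freely on $X$, let $R>1$, and let $\Gamma$ be the graph whose vertices are the walls $\overline W$ of $X/K$ (images of the walls $W$ of $X$), distinct walls being adjacent if their distance in $X/K$ is at most $R$. Let $k\in\mathbb N$ bound the vertex degrees of $\Gamma$, and let $C_{k+1}(\Gamma)$ be the set of proper colourings of $\Gamma$ with colours $1,\dots,k+1$, with $G$-action $gc=c\circ g^{-1}$. Write $c(e)=c(\overline{W(e)})$. For a wall $W$ let $[c]_W$ be the set of $c'\in C_{k+1}(\Gamma)$ that agree with $c$ on the ball of radius $c(\overline W)$ about $\overline W$ in $\Gamma$. For an edge $e$ put $[e,c]=\{e\}\times[c]_{W(e)}$,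 so that $g[e,c]=[ge,gc]$. Let $j\in\mathbb N$ and let $\mathcal V_j$ be a finite collection (duplicates allowed and counted separately) of triples $(Z,H,(c_x))$, where $Z\subset X$ is a non-empty intersection of closed half-spaces, $H<G$ is a subgroup preserving $Z$ and acting freely and cocompactly on it, and $c_x\in C_{k+1}(\Gamma)$ for every vertex $x$ of $X$ in $Z$, with $c_{hx}=hc_x$ for $h\in H$. Assume: 1. if an edge $e$ joins vertices $x,y\in Z$, then $[e,c_x]=[e,c_y]$; for an edge $e$ with an end $x\in Z$ write $[e,c_e]:=[e,c_x]$; 2. if an edge $e$ joins vertices $x,y$ with $x\in Z$, then $y\in Z\Leftrightarrow c_x(e)>j$; 3. (Gluing Equations) $|\mathcal V_j^+(f,c)|=|\mathcal V_j^-(f,c)|$ for all edges $f$ and all $c\in C_{k+1}(\Gamma)$, where $\mathcal V_j^\pm(f,c)$ is the set of pairs $(H\cdot e,Z)$ with $(Z,H,(c_x))\in\mathcal V_j$ such that some $g\in G$ satisfies $gZ\cap W(f)^\pm\ne\emptyset$ and $g[e,c_e]=[f,c]$. A *portal* leading to $(Z,H,(c_x))\in\mathcal V_j$ is a set $P=Z\cap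 W$, where $W$ is a wall dual to an edge $e$ that joins a vertex $x\in Z$ to a vertex outside $Z$ and has $c_x(e)=j$. Portals are always equipped with the triple they lead to. The edges dual to $W$ with exactly one end in $Z$ are called dual to $P$. Put $H_P=\{h\in H: hP=P\}$. Portals $P,P'$ leading to $(Z,H,(c_x)),(Z',H',(c'_x))$ are *compatible* if $[e,c_e]\in G\cdot[f,c'_f]$ for some $e$ dual to $P$ and some $f$ dual to $P'$; and $P$ is a *$g$-teleport* of $P'$ (where $g\in G$) if $\{[e,c_e]: e \text{ dual to } P\}=g\{[f,c'_f]: f\text{ dual to }P'\}$. Assume moreover that $H_P=gH'_{P'}g^{-1}$ whenever $P$ is a $g$-teleport of $P'$. Given a portal $P$ in a wall $W$, a compatible portal $P'$ leading to $(Z',H',(c'_x))$ is *$[P]^\pm$-compatible* if $gZ'\cap W^\pm\neq\emptyset$ for some $g\in G$ such that $P$ is a $g$-teleport of $P'$. The *portal quotient* of $P'$ is $P'/H'_{P'}$, regarded as a subspace of $Z'/H'$ (so portals in one $H'$-orbit have the same portal quotient, and triples of $\mathcal V_j$ are kept apart); it is $[P]^\pm$-compatible if it is the portal quotient of a $[P]^\pm$-compatible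 portal. **Lemma.** For every portal $P$, the numbers of $[P]^+$-compatible portal quotients and of $[P]^-$-compatible portal quotients are finite and equal. -/

import Mathlib

open scoped Pointwise

/-- The faces of the combinatorial `n`-cube `{0,1}ⁿ`: fix some coordinates, leave the others free. -/
def IsCubeFace {n : ℕ} (F : Set (Fin n → Bool)) : Prop :=
  ∃ (S : Set (Fin n)) (a : Fin n → Bool), F = {b | ∀ i ∈ S, b i = a i}

/-- A cube complex in which every cube is embedded and two cubes meet in a common face (or not at
all); a cube is recorded by its set of vertices. Every CAT(0) cube complex is of this kind. -/
structure CubeComplex (V : Type*) where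
  /-- the vertex sets of the cubes -/
  cubes : Set (Set V)
  /-- a cube is a copy of `{0,1}ⁿ`, and the cubes contained in it are exactly its faces -/
  exists_chart : ∀ C ∈ cubes, ∃ (n : ℕ) (φ : (Fin n → Bool) → V),
    (Function.Injective φ ∧ ∀ F : Set (Fin n → Bool), φ '' F ∈ cubes ↔ IsCubeFace F) ∧
      Set.range φ = C
  singleton_mem : ∀ v : V, {v} ∈ cubes
  inter_mem : ∀ C ∈ cubes, ∀ D ∈ cubes, (C ∩ D).Nonempty → C ∩ D ∈ cubes

namespace CubeComplex

noncomputable section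

variable {V : Type*} (X : CubeComplex V)

/-- `φ` identifies the combinatorial `n`-cube with a cube of `X`. -/
def IsChart {n : ℕ} (φ : (Fin n → Bool) → V) : Prop :=
  Function.Injective φ ∧ ∀ F : Set (Fin n → Bool), φ '' F ∈ X.cubes ↔ IsCubeFace F

/-! ### Edges, walls, nonpositive curvature, simple connectivity -/

/-- `x` and `y` are the two ends of an edge. -/
def Adj (x y : V) : Prop := x ≠ y ∧ ({x, y} : Set V) ∈ X.cubes

/-- The graph on the vertices of `X` formed by its edges. -/
def graph : SimpleGraph V where
  Adj := X.Adj
  symm := ⟨fun x y h => ⟨h.1.symm, by rw [Set.pair_comm]; exact h.2⟩⟩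
  loopless := ⟨fun _ h => h.1 rfl⟩

/-- The (unoriented) edges of `X`, as sets of two vertices. -/
def Edge : Type _ := {e : Set V // ∃ x y, X.Adj x y ∧ e = {x, y}}

/-- `a, b, c, d` are the vertices of a square, in cyclic order. -/
def IsSquare (a b c d : V) : Prop :=
  X.Adj a b ∧ X.Adj b c ∧ X.Adj c d ∧ X.Adj d a ∧ a ≠ c ∧ b ≠ d ∧
    ({a, b, c, d} : Set V) ∈ X.cubes

/-- `e` and `f` are opposite edges of a square, so their midpoints are the two ends of a midcube of
that square. -/
def Opposite (e f : X.Edge) : Prop :=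
  ∃ a b c d, X.IsSquare a b c d ∧ e.1 = {a, b} ∧ f.1 = {d, c}

/-- Walls are the components of the complex of midcubes. The vertices of that complex are the
midpoints of the edges of `X`, and its edges are the midcubes of the squares of `X`. -/
def Wall : Type _ := Quotient (Relation.EqvGen.setoid X.Opposite)

/-- `W(e)`, the wall dual to the edge `e`. -/
def wall (e : X.Edge) : X.Wall := Quotient.mk _ e

/-- The elementary homotopies of edge paths: deleting a backtrack, and pushing the path across a
square. -/
inductive ElementaryHomotopy {u v : V} : X.graph.Walk u v → X.graph.Walk u v → Prop
  | backtrack {a b : V} (p : X.graph.Walk u a) (h : X.graph.Adj a b) (q : X.graph.Walk a v) :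
      ElementaryHomotopy (p.append (.cons h (.cons h.symm q))) (p.append q)
  | square {a b c d : V} (p : X.graph.Walk u a) (q : X.graph.Walk c v)
      (hab : X.graph.Adj a b) (hbc : X.graph.Adj b c)
      (had : X.graph.Adj a d) (hdc : X.graph.Adj d c) (hs : X.IsSquare a b c d) :
      ElementaryHomotopy (p.append (.cons hab (.cons hbc q))) (p.append (.cons had (.cons hdc q)))

/-- `X` is nonempty, connected, and every edge loop is null-homotopic. -/
def IsSimplyConnected : Prop :=
  X.graph.Connected ∧ ∀ (u : V) (p : X.graph.Walk u u),
    Relation.EqvGen X.ElementaryHomotopy p .nil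

/-- The link of every vertex is a flag complex: edges at `v` that pairwise span a square at `v`
span a cube. -/
def IsNPC : Prop :=
  ∀ (v : V) (S : Finset V), (∀ u ∈ S, X.Adj v u) →
    (∀ u ∈ S, ∀ w ∈ S, u ≠ w → ∃ C ∈ X.cubes, v ∈ C ∧ u ∈ C ∧ w ∈ C) →
    ∃ C ∈ X.cubes, v ∈ C ∧ (S : Set V) ⊆ C

/-- CAT(0) cube complexes. -/
def IsCAT0 : Prop := X.IsNPC ∧ X.IsSimplyConnected

/-! ### The geometric realisation and its metric -/

open Classical in
/-- The point with coordinates `t ∈ [0,1]ⁿ` in the cube with chart `φ`, recorded by the weights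
`∏ᵢ (tᵢ or 1 - tᵢ)` that it gives to the vertices of the cube. These weights determine the smallest
face containing the point and its coordinates there, and they do not depend on the cube and the chart
in which the point is described. -/
def cubePoint {n : ℕ} (φ : (Fin n → Bool) → V) (t : Fin n → ℝ) : V → ℝ :=
  fun v => ∑ b : Fin n → Bool, if φ b = v then ∏ i, (if b i then t i else 1 - t i) else 0

/-- `w` is the point with coordinates `t ∈ [0,1]ⁿ` in the cube of `X` with chart `φ`. -/
def HasCoords (w : V → ℝ) {n : ℕ} (φ : (Fin n → Bool) → V) (t : Fin n → ℝ) : Prop :=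
  X.IsChart φ ∧ (∀ i, t i ∈ Set.Icc (0 : ℝ) 1) ∧ w = cubePoint φ t

/-- The points of (the geometric realisation of) `X`. -/
def Point : Type _ :=
  {w : V → ℝ // ∃ (n : ℕ) (φ : (Fin n → Bool) → V) (t : Fin n → ℝ), X.HasCoords w φ t}

/-- The vertex `v` as a point of `X`. -/
def vertexPoint (v : V) : X.Point :=
  ⟨fun u => by classical exact if v = u then 1 else 0, by
    classical
    obtain ⟨n, φ, hφ, hr⟩ := X.exists_chart {v} (X.singleton_mem v)
    refine ⟨n, φ, fun _ => 0, hφ, fun _ => by simp, ?_⟩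
    have hv : ∀ b, φ b = v := fun b => by
      have : φ b ∈ Set.range φ := ⟨b, rfl⟩
      rw [hr] at this
      exact this
    have hone : ∀ b : Fin n → Bool, b = fun _ => false := fun b => hφ.1 (by rw [hv, hv])
    funext u
    unfold cubePoint
    rw [Fintype.sum_eq_single (fun _ => false) (fun b hb => absurd (hone b) hb)]
    simp [hv]⟩

/-- The closed cube with vertex set `C`. -/
def closedCube (C : Set V) : Set X.Point :=
  {p | ∃ (n : ℕ) (φ : (Fin n → Bool) → V) (t : Fin n → ℝ), X.HasCoords p.1 φ t ∧ Set.range φ = C}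

/-- `p` and `q` lie in a common cube and have Euclidean distance `ℓ` in it. -/
def IsSegment (p q : X.Point) (ℓ : ℝ) : Prop :=
  ∃ (n : ℕ) (φ : (Fin n → Bool) → V) (s t : Fin n → ℝ),
    X.HasCoords p.1 φ s ∧ X.HasCoords q.1 φ t ∧ ℓ = √(∑ i, (s i - t i) ^ 2)

/-- There is a piecewise linear path of length `ℓ` from `p` to `q`. -/
inductive StringLength : X.Point → X.Point → ℝ → Prop
  | nil (p : X.Point) : StringLength p p 0
  | cons {p q r : X.Point} {ℓ m : ℝ} :
      X.IsSegment p q ℓ → StringLength q r m → StringLength p r (ℓ + m)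

/-- The metric of `X`: the infimum of the lengths of piecewise linear paths. -/
def dist (p q : X.Point) : ℝ := sInf {ℓ | X.StringLength p q ℓ}

variable {X}

/-- The vertices of `X` in the subspace `Z`. -/
def vertices (Z : Set X.Point) : Set V := {x | X.vertexPoint x ∈ Z}

/-- The wall `W` as a subspace of `X`: the union of its midcubes. -/
def Wall.points (W : X.Wall) : Set X.Point :=
  {p | ∃ (n : ℕ) (φ : (Fin n → Bool) → V) (t : Fin n → ℝ) (i : Fin n) (b : Fin n → Bool) (e : X.Edge),
    X.HasCoords p.1 φ t ∧ t i = 1 / 2 ∧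
      e.1 = {φ b, φ (Function.update b i (!b i))} ∧ X.wall e = W}

/-- `x` and `y` are joined by an edge path that never crosses `W`. -/
def Wall.SameSide (W : X.Wall) (x y : V) : Prop :=
  Relation.ReflTransGen (fun u v => ∃ e : X.Edge, e.1 = {u, v} ∧ X.wall e ≠ W) x y

/-- The closed half-space of `W` containing the vertex `x`: all cubes whose vertices are all on the
side of `x`, and the halves, on the side of `x`, of the cubes with a midcube in `W`. -/
def Wall.halfSpace (W : X.Wall) (x : V) : Set X.Point :=
  {p | ∃ (n : ℕ) (φ : (Fin n → Bool) → V) (t : Fin n → ℝ), X.HasCoords p.1 φ t ∧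
    ((∀ b, W.SameSide x (φ b)) ∨
      ∃ (i : Fin n) (b : Fin n → Bool) (e : X.Edge),
        e.1 = {φ b, φ (Function.update b i (!b i))} ∧ X.wall e = W ∧
          W.SameSide x (φ b) ∧ |t i - (if b i then 1 else 0)| ≤ 1 / 2)}

/-- The set `s` of vertices is contained in a cube that meets `W`. -/
def Wall.InCarrier (W : X.Wall) (s : Set V) : Prop :=
  ∃ C ∈ X.cubes, s ⊆ C ∧ ∃ e : X.Edge, e.1 ⊆ C ∧ X.wall e = W

/-- `S` is a side of `W`: a class of vertices of `N(W)`, the union of the cubes meeting `W`, under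
being joined by an edge path in `N(W)` that never crosses `W`. -/
def Wall.IsSide (W : X.Wall) (S : Set V) : Prop :=
  ∃ x, W.InCarrier {x} ∧ S = {y | Relation.ReflTransGen
    (fun u v => ∃ e : X.Edge, e.1 = {u, v} ∧ W.InCarrier e.1 ∧ X.wall e ≠ W) x y}

/-! ### Group actions -/

variable (X) in
/-- The action of `G` on the vertices of `X` is an action on the cube complex `X`. -/
class CubicalAction (G : Type*) [Group G] [MulAction G V] : Prop where
  smul_mem : ∀ (g : G), ∀ C ∈ X.cubes, g • C ∈ X.cubes

variable {G : Type*} [Group G] [MulAction G V] [X.CubicalAction G]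

lemma isChart_smul (g : G) {n : ℕ} {φ : (Fin n → Bool) → V} (hφ : X.IsChart φ) :
    X.IsChart (fun b => g • φ b) := by
  have key : ∀ F : Set (Fin n → Bool), (fun b => g • φ b) '' F = g • (φ '' F) := fun F => by
    rw [← Set.image_smul, Set.image_image]
  refine ⟨fun a b h => hφ.1 (MulAction.injective g h), fun F => ?_⟩
  rw [key, ← hφ.2 F]
  refine ⟨fun h => ?_, CubicalAction.smul_mem g _⟩
  have := CubicalAction.smul_mem (X := X) g⁻¹ _ h
  rwa [inv_smul_smul] at this

lemma adj_smul (g : G) {x y : V} (h : X.Adj x y) : X.Adj (g • x) (g • y) := by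
  refine ⟨fun h' => h.1 (MulAction.injective g h'), ?_⟩
  have := CubicalAction.smul_mem (X := X) g _ h.2
  rwa [← Set.image_smul, Set.image_pair] at this

lemma isSquare_smul (g : G) {a b c d : V} (h : X.IsSquare a b c d) :
    X.IsSquare (g • a) (g • b) (g • c) (g • d) := by
  obtain ⟨h1, h2, h3, h4, h5, h6, h7⟩ := h
  refine ⟨adj_smul g h1, adj_smul g h2, adj_smul g h3, adj_smul g h4,
    fun h => h5 (MulAction.injective g h), fun h => h6 (MulAction.injective g h), ?_⟩
  have := CubicalAction.smul_mem (X := X) g _ h7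
  rwa [← Set.image_smul, Set.image_insert_eq, Set.image_insert_eq, Set.image_pair] at this

instance : MulAction G X.Edge where
  smul g e := ⟨g • e.1, by
    obtain ⟨x, y, h, he⟩ := e.2
    exact ⟨g • x, g • y, adj_smul g h, by rw [he, ← Set.image_smul, Set.image_pair]⟩⟩
  one_smul e := Subtype.ext (one_smul G e.1)
  mul_smul g h e := Subtype.ext (mul_smul g h e.1)

lemma opposite_smul (g : G) {e f : X.Edge} (h : X.Opposite e f) : X.Opposite (g • e) (g • f) := by
  obtain ⟨a, b, c, d, hs, he, hf⟩ := h
  refine ⟨g • a, g • b, g • c, g • d, isSquare_smul g hs, ?_, ?_⟩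
  · change g • e.1 = _
    rw [he, ← Set.image_smul, Set.image_pair]
  · change g • f.1 = _
    rw [hf, ← Set.image_smul, Set.image_pair]

lemma eqvGen_opposite_smul (g : G) {e f : X.Edge} (h : Relation.EqvGen X.Opposite e f) :
    Relation.EqvGen X.Opposite (g • e) (g • f) := by
  induction h with
  | rel _ _ h => exact .rel _ _ (opposite_smul g h)
  | refl _ => exact .refl _
  | symm _ _ _ ih => exact .symm _ _ ih
  | trans _ _ _ _ _ ih₁ ih₂ => exact .trans _ _ _ ih₁ ih₂

instance : MulAction G X.Wall where
  smul g := Quotient.map (fun e => g • e) fun _ _ h => eqvGen_opposite_smul g h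
  one_smul W := Quotient.inductionOn W fun e => congrArg (Quotient.mk _) (one_smul G e)
  mul_smul g h W := Quotient.inductionOn W fun e => congrArg (Quotient.mk _) (mul_smul g h e)

lemma cubePoint_smul (g : G) {n : ℕ} (φ : (Fin n → Bool) → V) (t : Fin n → ℝ) :
    (fun v => cubePoint φ t (g⁻¹ • v)) = cubePoint (fun b => g • φ b) t := by
  funext v
  unfold cubePoint
  refine Finset.sum_congr rfl fun b _ => ?_
  by_cases h : φ b = g⁻¹ • v
  · rw [if_pos h, if_pos (eq_inv_smul_iff.1 h)]
  · rw [if_neg h, if_neg fun h' => h (eq_inv_smul_iff.2 h')]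

lemma hasCoords_smul (g : G) {w : V → ℝ} {n : ℕ} {φ : (Fin n → Bool) → V} {t : Fin n → ℝ}
    (h : X.HasCoords w φ t) : X.HasCoords (fun v => w (g⁻¹ • v)) (fun b => g • φ b) t :=
  ⟨isChart_smul g h.1, h.2.1, by rw [h.2.2, cubePoint_smul]⟩

instance : MulAction G X.Point where
  smul g p := ⟨fun v => p.1 (g⁻¹ • v), by
    obtain ⟨n, φ, t, h⟩ := p.2
    exact ⟨n, _, t, hasCoords_smul g h⟩⟩
  one_smul p := Subtype.ext <| funext fun v => by
    change p.1 ((1 : G)⁻¹ • v) = p.1 v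
    rw [inv_one, one_smul]
  mul_smul g h p := Subtype.ext <| funext fun v => by
    change p.1 ((g * h)⁻¹ • v) = p.1 (h⁻¹ • g⁻¹ • v)
    rw [mul_inv_rev, mul_smul]

lemma stringLength_smul (g : G) {p q : X.Point} {ℓ : ℝ} (h : X.StringLength p q ℓ) :
    X.StringLength (g • p) (g • q) ℓ := by
  induction h with
  | nil p => exact .nil _
  | cons hs _ ih =>
    obtain ⟨n, φ, s, t, hp, hq, hl⟩ := hs
    exact .cons ⟨n, _, s, t, hasCoords_smul g hp, hasCoords_smul g hq, hl⟩ ih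

lemma dist_smul (g : G) (p q : X.Point) : X.dist (g • p) (g • q) = X.dist p q := by
  unfold dist
  congr 1
  ext ℓ
  refine ⟨fun h => ?_, stringLength_smul g⟩
  have := stringLength_smul g⁻¹ h
  rwa [inv_smul_smul, inv_smul_smul] at this

lemma points_smul (g : G) {W : X.Wall} {p : X.Point} (hp : p ∈ W.points) :
    g • p ∈ (g • W).points := by
  obtain ⟨n, φ, t, i, b, e, h, ht, he, hW⟩ := hp
  refine ⟨n, _, t, i, b, g • e, hasCoords_smul g h, ht, ?_, by rw [← hW]; rfl⟩
  change g • e.1 = _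
  rw [he, ← Set.image_smul, Set.image_pair]

variable (X) in
/-- `G` acts properly on `X`: every point has a ball that meets only finitely many of its
translates. -/
def IsProperAction (G : Type*) [Group G] [MulAction G V] [X.CubicalAction G] : Prop :=
  ∀ p : X.Point, ∃ r > 0, {g : G | ∃ q, X.dist p q < r ∧ X.dist p (g • q) < r}.Finite

/-- The subgroup `H` acts cocompactly on the closed subspace `Z`: finitely many (compact) cubes of
`X` have `H`-translates that cover `Z`. -/
def IsCocompactOn (H : Subgroup G) (Z : Set X.Point) : Prop :=
  ∃ F : Set (Set V), F.Finite ∧ F ⊆ X.cubes ∧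
    ∀ p ∈ Z, ∃ h ∈ H, ∃ C ∈ F, h • p ∈ X.closedCube C

variable (X G) in
/-- A labelling of the two sides of every wall `W` as `W⁺` (`true`) and `W⁻` (`false`), compatible
with the action of `G`. In particular the stabiliser of `W` does not exchange the sides of `W`. -/
structure SideLabelling where
  side : X.Wall → Bool → Set V
  isSide_iff : ∀ W S, W.IsSide S ↔ S = side W true ∨ S = side W false
  ne : ∀ W, side W true ≠ side W false
  side_smul : ∀ (g : G) W s, side (g • W) s = g • side W s

/-! ### The quotient by `K`, the graph `Γ` and its colourings -/

variable (X) in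
/-- The walls of `X / K`: they are the images of the walls of `X`. -/
def QuotWall (K : Subgroup G) : Type _ := MulAction.orbitRel.Quotient K X.Wall

/-- The image in `X / K` of a wall of `X`. -/
def Wall.bar (W : X.Wall) (K : Subgroup G) : X.QuotWall K :=
  Quotient.mk (MulAction.orbitRel K X.Wall) W

variable {K : Subgroup G}

/-- The distance in `X / K` between two walls. (The metric of `X / K` is the quotient metric, in
which the distance between two points is the infimum of the distances between their preimages.) -/
def QuotWall.dist (a b : X.QuotWall K) : ℝ :=
  sInf {d | ∃ W₁ W₂ : X.Wall, W₁.bar K = a ∧ W₂.bar K = b ∧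
    ∃ p ∈ W₁.points, ∃ q ∈ W₂.points, d = X.dist p q}

variable (X) in
/-- The graph `Γ`: its vertices are the walls of `X / K`, and two distinct ones are joined by an edge
if their distance is at most `R`. -/
def wallGraph (K : Subgroup G) (R : ℝ) : SimpleGraph (X.QuotWall K) :=
  SimpleGraph.fromRel fun a b => a.dist b ≤ R

variable (X) in
/-- The set `C_{k+1}(Γ)` of colourings of `Γ` with colours `1, …, k + 1`. -/
def Colouring (K : Subgroup G) (R : ℝ) (k : ℕ) : Type _ :=
  (X.wallGraph K R).Coloring (Set.Icc 1 (k + 1) : Set ℕ)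

/-- The colour that `c` gives to a wall of `X / K`. -/
def Colouring.colour {R : ℝ} {k : ℕ} (c : X.Colouring K R k) (a : X.QuotWall K) : ℕ :=
  (show (X.wallGraph K R).Coloring (Set.Icc 1 (k + 1) : Set ℕ) from c) a

section NormalSubgroup

variable [K.Normal]

instance : MulAction G (X.QuotWall K) where
  smul g := Quotient.map (fun W => g • W) fun W₁ W₂ h => by
    obtain ⟨k, rfl⟩ := h
    refine ⟨⟨g * k * g⁻¹, (inferInstance : K.Normal).conj_mem k k.2 g⟩, ?_⟩
    change (g * k * g⁻¹) • g • W₂ = g • (k : G) • W₂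
    rw [smul_smul, smul_smul, inv_mul_cancel_right]
  one_smul a := Quotient.inductionOn a fun W => congrArg (Quotient.mk _) (one_smul G W)
  mul_smul g h a := Quotient.inductionOn a fun W => congrArg (Quotient.mk _) (mul_smul g h W)

lemma QuotWall.dist_smul (g : G) (a b : X.QuotWall K) : (g • a).dist (g • b) = a.dist b := by
  have key : ∀ (g : G) (a b : X.QuotWall K) (d : ℝ),
      (∃ W₁ W₂ : X.Wall, W₁.bar K = a ∧ W₂.bar K = b ∧
        ∃ p ∈ W₁.points, ∃ q ∈ W₂.points, d = X.dist p q) →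
      (∃ W₁ W₂ : X.Wall, W₁.bar K = g • a ∧ W₂.bar K = g • b ∧
        ∃ p ∈ W₁.points, ∃ q ∈ W₂.points, d = X.dist p q) := by
    rintro g _ _ _ ⟨W₁, W₂, rfl, rfl, p, hp, q, hq, rfl⟩
    exact ⟨g • W₁, g • W₂, rfl, rfl, g • p, points_smul g hp, g • q, points_smul g hq,
      (CubeComplex.dist_smul g p q).symm⟩
  unfold QuotWall.dist
  congr 1
  ext d
  refine ⟨fun h => ?_, key g a b d⟩
  have := key g⁻¹ _ _ d h
  rwa [inv_smul_smul, inv_smul_smul] at this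

lemma wallGraph_adj_smul {R : ℝ} (g : G) {a b : X.QuotWall K} (h : (X.wallGraph K R).Adj a b) :
    (X.wallGraph K R).Adj (g • a) (g • b) := by
  simp only [wallGraph, SimpleGraph.fromRel_adj, QuotWall.dist_smul] at h ⊢
  exact ⟨fun h' => h.1 (MulAction.injective g h'), h.2⟩

variable {R : ℝ} {k : ℕ}

/-- The action `g c = c ∘ g⁻¹` on colourings. -/
instance : SMul G (X.Colouring K R k) where
  smul g c := SimpleGraph.Coloring.mk
    (fun a => (show (X.wallGraph K R).Coloring (Set.Icc 1 (k + 1) : Set ℕ) from c) (g⁻¹ • a))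
    fun h => SimpleGraph.Coloring.valid _ (wallGraph_adj_smul g⁻¹ h)

/-- The class `[c]_W`: the colourings that agree with `c` on the ball of radius `c(W̄)` about `W̄`
in `Γ`. -/
def colourClass (W : X.Wall) (c : X.Colouring K R k) : Set (X.Colouring K R k) :=
  {c' | ∀ a, (X.wallGraph K R).edist (W.bar K) a ≤ (c.colour (W.bar K) : ℕ∞) →
    c'.colour a = c.colour a}

/-- The class `[e, c] = {e} × [c]_{W(e)}`. The group `G` acts on these classes by translation of sets
of pairs. -/
def edgeClass (e : X.Edge) (c : X.Colouring K R k) : Set (X.Edge × X.Colouring K R k) :=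
  {e} ×ˢ colourClass (X.wall e) c

/-! ### The collections `𝒱_j` -/

variable (X K R k) in
/-- The triples `(Z, H, (c_x))`. -/
structure Triple where
  Z : Set X.Point
  H : Subgroup G
  /-- the colourings `c_x` of the vertices `x` of `Z` -/
  c : vertices Z → X.Colouring K R k
  nonempty : Z.Nonempty
  /-- `Z` is an intersection of half-spaces -/
  isInter : ∃ 𝓗 : Set (Set X.Point), (∀ A ∈ 𝓗, ∃ (W : X.Wall) (x : V), A = W.halfSpace x) ∧
    Z = ⋂₀ 𝓗
  smul_Z : ∀ h ∈ H, h • Z = Z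
  /-- `H` acts freely on `Z` -/
  free : ∀ h ∈ H, ∀ z ∈ Z, h • z = z → h = 1
  cocompact : IsCocompactOn H Z
  /-- `c_{hx} = h c_x` -/
  equivariant : ∀ h ∈ H, ∀ x y : vertices Z, y.1 = h • x.1 → c y = h • c x

/-- The class `[e, c_e]`, which is `[e, c_x]` for any end `x` of `e` in `Z` (these classes agree if
both ends of `e` are in `Z`). It is empty if `e` has no end in `Z`. -/
def Triple.edgeClass (T : X.Triple K R k) (e : X.Edge) : Set (X.Edge × X.Colouring K R k) :=
  {q | ∃ x : vertices T.Z, x.1 ∈ e.1 ∧ q ∈ CubeComplex.edgeClass e (T.c x)}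

/-- The edge `e` crosses out of `Z`. -/
def Triple.CrossesOut (T : X.Triple K R k) (e : X.Edge) : Prop :=
  (∃ x ∈ e.1, x ∈ vertices T.Z) ∧ ∃ y ∈ e.1, y ∉ vertices T.Z

variable {ι : Type*}

/-- The set `𝒱_j^±(f, c)` of all `(H · e, Z)` such that some `g ∈ G` satisfies `gZ ∩ W(f)^± ≠ ∅` and
`g[e, c_e] = [f, c]`. The index `i` of the triple keeps duplicates apart. -/
def gluingSet (L : X.SideLabelling G) (T : ι → X.Triple K R k) (s : Bool) (f : X.Edge)
    (c : X.Colouring K R k) : Set (ι × Set X.Edge) :=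
  {q | ∃ (i : ι) (e : X.Edge), q = (i, MulAction.orbit (T i).H e) ∧
    ∃ g : G, (g • vertices (T i).Z ∩ L.side (X.wall f) s).Nonempty ∧
      g • (T i).edgeClass e = edgeClass f c}

/-- The properties of the collection `𝒱_j`. -/
structure IsStage (L : X.SideLabelling G) (j : ℕ) (T : ι → X.Triple K R k) : Prop where
  /-- adjacent vertices have similar colourings -/
  edgeClass_eq : ∀ i (e : X.Edge) (x y : vertices (T i).Z), e.1 = {x.1, y.1} →
    edgeClass e ((T i).c x) = edgeClass e ((T i).c y)
  /-- the colours tell which edges leave `Z` -/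
  mem_iff : ∀ i (e : X.Edge) (x : vertices (T i).Z) (y : V), e.1 = {x.1, y} →
    (y ∈ vertices (T i).Z ↔ j < ((T i).c x).colour ((X.wall e).bar K))
  /-- the Gluing Equations -/
  gluing : ∀ (f : X.Edge) (c : X.Colouring K R k),
    (gluingSet L T true f c).encard = (gluingSet L T false f c).encard

/-! ### Portals -/

/-- A portal, given by the triple that it leads to and by the `j`-boundary wall containing it: a wall
dual to an edge that crosses out of `Z` and has colour `j`. -/
structure Portal (j : ℕ) (T : ι → X.Triple K R k) where
  idx : ι
  wall : X.Wall
  isBoundary : ∃ e : X.Edge, (T idx).CrossesOut e ∧ X.wall e = wall ∧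
    ∃ x : vertices (T idx).Z, x.1 ∈ e.1 ∧ ((T idx).c x).colour (wall.bar K) = j

namespace Portal

variable {j : ℕ} {T : ι → X.Triple K R k}

/-- The triple that the portal leads to. -/
def triple (P : Portal j T) : X.Triple K R k := T P.idx

/-- The portal as a subspace of `X`. -/
def carrier (P : Portal j T) : Set X.Point := P.triple.Z ∩ P.wall.points

/-- The edge `e` is dual to the portal `P`. -/
def Dual (P : Portal j T) (e : X.Edge) : Prop := P.triple.CrossesOut e ∧ X.wall e = P.wall

/-- `P` and `P'` are compatible. -/
def Compatible (P P' : Portal j T) : Prop :=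
  ∃ e f, P.Dual e ∧ P'.Dual f ∧ ∃ g : G, P.triple.edgeClass e = g • P'.triple.edgeClass f

/-- `P` is a `g`-teleport of `P'`. -/
def IsTeleport (g : G) (P P' : Portal j T) : Prop :=
  P.triple.edgeClass '' {e | P.Dual e} = g • (P'.triple.edgeClass '' {f | P'.Dual f})

/-- The stabiliser `H_P`. -/
def stab (P : Portal j T) : Subgroup G := P.triple.H ⊓ MulAction.stabilizer G P.carrier

/-- `P'` is a `[P]⁺`-compatible (for `s = true`) or `[P]⁻`-compatible (for `s = false`) portal. -/
def IsSignCompatible (L : X.SideLabelling G) (P : Portal j T) (s : Bool) (P' : Portal j T) : Prop :=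
  P.Compatible P' ∧ ∃ g : G, IsTeleport g P P' ∧
    (g • vertices P'.triple.Z ∩ L.side P.wall s).Nonempty

/-- The portal quotient `P / H_P`, as a subspace of `Z / H`: the set of the `H`-orbits of the points
of `P`. The index keeps the spaces `Z / H` of different triples apart. -/
def quotient (P : Portal j T) : ι × Set (Set X.Point) :=
  (P.idx, MulAction.orbit P.triple.H '' P.carrier)

/-- The set of `[P]^±`-compatible portal quotients. -/
def compatibleQuotients (L : X.SideLabelling G) (P : Portal j T) (s : Bool) :
    Set (ι × Set (Set X.Point)) :=
  {q | ∃ P' : Portal j T, IsSignCompatible L P s P' ∧ q = P'.quotient}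

end Portal

end NormalSubgroup

end

end CubeComplex

/-! Let `P` lie in the wall `W` and let `e₀` be an edge dual to `P`. One colouring `c` represents
the classes of all edges dual to `P` (`exists_isColouring`): any two of them are linked by squares
with an edge in `Z`; such an edge has colour greater than `j` and its wall crosses `W`, so moving
along it changes no colour in the ball of radius `j` about `W`. As `j ≥ 1`, this ball also contains
the walls crossing `W` in a square, and their colours decide which edges opposite to a dual edge are
again dual. Hence one coincidence of classes spreads over the whole portal and gives a teleport
(`isTeleport_of_edgeClass_eq`).

The lemma then follows by double counting. Sending an orbit of edges to the quotient of the portal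
dual to them maps the gluing set of `(e₀, c)` with sign `s` onto the compatible quotients of that
sign (`image_gluingSet`). If `g` exhibits `P'` as compatible, the fibre over the quotient of `P'`
consists of the `H'`-orbits of `g⁻¹ t e₀`, with `t` a self-teleport of `P` (`gluingSet_fibre_eq`).
By conjugacy of the stabilisers these correspond to the `H_P`-orbits of the edges `t e₀`
(`injOn_translateOrbit`). Self-teleports preserve the sides of `W`, so the size of the fibres
depends neither on `P'` nor on the sign, and the Gluing Equations finish the proof.

The geometric input is that `Z` is convex and that portals are connected. It comes from
`Reduced.flipEq`: reduced edge paths with the same ends differ by flips across squares. To prove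
this, edge paths act on flip classes of reduced paths from a base vertex. The flag condition makes
the action well defined and invariant under homotopy, and simple connectivity makes loops act
trivially. It follows that a reduced path crosses each wall at most once and stays in every
half-space containing its ends. -/

namespace CubeComplex

/-! ### Squares, charts and the completion of three squares to a 3-cube. -/

section Squares

variable {V : Type*} {X : CubeComplex V}

lemma Adj.symm {x y : V} (h : X.Adj x y) : X.Adj y x :=
  ⟨h.1.symm, by rw [Set.pair_comm]; exact h.2⟩

lemma IsSquare.reflect {a b c d : V} (h : X.IsSquare a b c d) : X.IsSquare a d c b := by
  obtain ⟨h1, h2, h3, h4, h5, h6, h7⟩ := h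
  refine ⟨h4.symm, h3.symm, h2.symm, h1.symm, h5, h6.symm, ?_⟩
  rwa [show ({a, d, c, b} : Set V) = {a, b, c, d} by ext; simp; tauto]

lemma IsSquare.rotate {a b c d : V} (h : X.IsSquare a b c d) : X.IsSquare b c d a := by
  obtain ⟨h1, h2, h3, h4, h5, h6, h7⟩ := h
  refine ⟨h2, h3, h4, h1, h6, h5.symm, ?_⟩
  rwa [show ({b, c, d, a} : Set V) = {a, b, c, d} by ext; simp; tauto]

lemma IsSquare.flip {a b c d : V} (h : X.IsSquare a b c d) : X.IsSquare b a d c :=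
  h.reflect.rotate.rotate.rotate

/-- Neighbouring vertices of a chart differ in exactly one coordinate. -/
lemma IsChart.exists_update_of_adj {n : ℕ} {φ : (Fin n → Bool) → V} (hφ : X.IsChart φ)
    {b b' : Fin n → Bool} (h : X.Adj (φ b) (φ b')) : ∃ i, b' = Function.update b i (!b i) := by
  have hne : b ≠ b' := fun hb => h.1 (by rw [hb])
  obtain ⟨S, a, hS⟩ := (hφ.2 {b, b'}).1 (by rw [Set.image_pair]; exact h.2)
  obtain ⟨i, hi⟩ := Function.ne_iff.1 hne
  have hb : b ∈ ({b, b'} : Set (Fin n → Bool)) := by simp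
  have hb' : b' ∈ ({b, b'} : Set (Fin n → Bool)) := by simp
  rw [hS] at hb hb'
  have hiS : i ∉ S := fun hiS => hi ((hb i hiS).trans (hb' i hiS).symm)
  have : Function.update b i (!b i) ∈ ({b, b'} : Set (Fin n → Bool)) := by
    rw [hS]
    intro k hk
    rw [Function.update_of_ne (fun h : k = i => hiS (h ▸ hk))]
    exact hb k hk
  refine ⟨i, ?_⟩
  rcases this with h | h
  · have := congrFun h i
    simp at this
  · exact h.symm

lemma IsChart.adj_update {n : ℕ} {φ : (Fin n → Bool) → V} (hφ : X.IsChart φ)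
    (b : Fin n → Bool) (i : Fin n) : X.Adj (φ b) (φ (Function.update b i (!b i))) := by
  have hne : b ≠ Function.update b i (!b i) := fun h => by
    have := congrFun h i
    simp at this
  refine ⟨fun h => hne (hφ.1 h), ?_⟩
  rw [← Set.image_pair, hφ.2]
  refine ⟨{i}ᶜ, b, ?_⟩
  ext β
  simp only [Set.mem_insert_iff, Set.mem_singleton_iff, Set.mem_compl_iff, Set.mem_ofPred_eq]
  constructor
  · rintro (rfl | rfl) k hk
    · rfl
    · rw [Function.update_of_ne hk]
  · intro h
    by_cases hi : β i = b i
    · left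
      funext k
      by_cases hk : k = i
      · rw [hk, hi]
      · exact h k hk
    · right
      funext k
      by_cases hk : k = i
      · subst hk
        rw [Function.update_self]
        exact Bool.eq_not_of_ne hi
      · rw [Function.update_of_ne hk]
        exact h k hk

lemma update_not_comm {n : ℕ} (b : Fin n → Bool) {i k : Fin n} (hik : i ≠ k) :
    Function.update (Function.update b i (!b i)) k (!(Function.update b i (!b i)) k) =
      Function.update (Function.update b k (!b k)) i (!(Function.update b k (!b k)) i) := by
  rw [Function.update_of_ne hik.symm, Function.update_of_ne hik, Function.update_comm hik]

lemma IsChart.isSquare_update {n : ℕ} {φ : (Fin n → Bool) → V} (hφ : X.IsChart φ)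
    (b : Fin n → Bool) {i k : Fin n} (hik : i ≠ k) :
    X.IsSquare (φ b) (φ (Function.update b i (!b i)))
      (φ (Function.update (Function.update b i (!b i)) k (!(Function.update b i (!b i)) k)))
      (φ (Function.update b k (!b k))) := by
  refine ⟨hφ.adj_update b i, hφ.adj_update _ k, ?_, (hφ.adj_update b k).symm, ?_, ?_, ?_⟩
  · rw [update_not_comm b hik]
    exact (hφ.adj_update _ i).symm
  · intro h
    have := congrFun (hφ.1 h) k
    rw [Function.update_self, Function.update_of_ne hik.symm] at this
    simp at this
  · intro h
    have := congrFun (hφ.1 h) i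
    rw [Function.update_self, Function.update_of_ne hik] at this
    simp at this
  · rw [show ({φ b, φ (Function.update b i (!b i)),
      φ (Function.update (Function.update b i (!b i)) k (!(Function.update b i (!b i)) k)),
      φ (Function.update b k (!b k))} : Set V) = φ '' {b, Function.update b i (!b i),
      Function.update (Function.update b i (!b i)) k (!(Function.update b i (!b i)) k),
      Function.update b k (!b k)} by simp [Set.image_insert_eq], hφ.2]
    refine ⟨{i, k}ᶜ, b, ?_⟩
    ext β
    simp only [Set.mem_insert_iff, Set.mem_singleton_iff, Set.mem_compl_iff, Set.mem_ofPred_eq,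
      not_or]
    constructor
    · rintro (rfl | rfl | rfl | rfl) l ⟨hl, hl'⟩ <;>
        simp [Function.update_of_ne hl, Function.update_of_ne hl']
    · intro h
      have key : ∀ γ : Fin n → Bool, γ i = β i → γ k = β k → (∀ l, l ≠ i → l ≠ k → γ l = b l) →
          β = γ := fun γ h1 h2 h3 => funext fun l => by
        by_cases hl : l = i
        · rw [hl, h1]
        · by_cases hl' : l = k
          · rw [hl', h2]
          · rw [h3 l hl hl', h l ⟨hl, hl'⟩]
      by_cases hi : β i = b i <;> by_cases hk : β k = b k
      · exact .inl (key b hi.symm hk.symm fun _ _ _ => rfl)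
      · refine .inr (.inr (.inr (key _ ?_ ?_ ?_)))
        · rw [Function.update_of_ne hik, hi]
        · rw [Function.update_self, Bool.eq_not_of_ne hk]
        · intro l _ hl
          rw [Function.update_of_ne hl]
      · refine .inr (.inl (key _ ?_ ?_ ?_))
        · rw [Function.update_self, Bool.eq_not_of_ne hi]
        · rw [Function.update_of_ne hik.symm, hk]
        · intro l hl _
          rw [Function.update_of_ne hl]
      · refine .inr (.inr (.inl (key _ ?_ ?_ ?_)))
        · rw [Function.update_of_ne hik, Function.update_self, Bool.eq_not_of_ne hi]
        · rw [Function.update_self, Function.update_of_ne hik.symm, Bool.eq_not_of_ne hk]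
        · intro l hl hl'
          rw [Function.update_of_ne hl', Function.update_of_ne hl]

lemma exists_ncard_eq_two_pow {C : Set V} (hC : C ∈ X.cubes) : ∃ n : ℕ, C.ncard = 2 ^ n := by
  obtain ⟨n, φ, hφ, rfl⟩ := X.exists_chart C hC
  refine ⟨n, ?_⟩
  rw [← Set.image_univ, Set.ncard_image_of_injective _ hφ.1, Set.ncard_univ]
  simp

lemma cube_finite {C : Set V} (hC : C ∈ X.cubes) : C.Finite := by
  obtain ⟨n, φ, hφ, rfl⟩ := X.exists_chart C hC
  exact Set.finite_range φ

/-- Three vertices of a square determine the fourth. -/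
lemma IsSquare.eq_of_eq {a b c d d' : V} (h : X.IsSquare a b c d) (h' : X.IsSquare a b c d') :
    d = d' := by
  by_contra hne
  obtain ⟨h1, h2, h3, h4, h5, h6, h7⟩ := h
  obtain ⟨h1', h2', h3', h4', h5', h6', h7'⟩ := h'
  -- Two distinct fourth vertices would make the intersection of the squares a cube with three
  -- vertices, which is not a power of two.
  have hI : ({a, b, c, d} ∩ {a, b, c, d'} : Set V) = {a, b, c} := by
    ext x
    simp only [Set.mem_inter_iff, Set.mem_insert_iff, Set.mem_singleton_iff]
    constructor
    · rintro ⟨rfl | rfl | rfl | rfl, hx⟩ <;> simp_all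
    · tauto
  have hm := X.inter_mem _ h7 _ h7' ⟨a, by simp, by simp⟩
  rw [hI] at hm
  obtain ⟨n, hn⟩ := exists_ncard_eq_two_pow hm
  have h3 : ({a, b, c} : Set V).ncard = 3 := by
    rw [Set.ncard_eq_three]
    exact ⟨a, b, c, h1.1, h5, h2.1, rfl⟩
  rw [h3] at hn
  rcases n with _ | n
  · simp at hn
  · rw [pow_succ] at hn
    omega

/-- Three squares that pairwise share an edge at a common vertex span a 3-cube. -/
lemma IsNPC.exists_opposite (hX : X.IsNPC) {o x y z a b c : V} (hxy : X.IsSquare o x a y)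
    (hyz : X.IsSquare o y b z) (hxz : X.IsSquare o x c z) :
    ∃ t, X.IsSquare x a t c ∧ X.IsSquare y a t b ∧ X.IsSquare z b t c := by
  classical
  have hx : X.Adj o x := hxy.1
  have hy : X.Adj o y := hyz.1
  have hz : X.Adj o z := hxz.2.2.2.1.symm
  obtain ⟨C, hC, hoC, hSC⟩ := hX o {x, y, z} (by
    intro u hu
    simp only [Finset.mem_insert, Finset.mem_singleton] at hu
    rcases hu with rfl | rfl | rfl <;> assumption) (by
    intro u hu w hw huw
    simp only [Finset.mem_insert, Finset.mem_singleton] at hu hw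
    rcases hu with rfl | rfl | rfl <;> rcases hw with rfl | rfl | rfl <;>
      first
      | exact absurd rfl huw
      | (refine ⟨_, hxy.2.2.2.2.2.2, ?_, ?_, ?_⟩ <;> simp; done)
      | (refine ⟨_, hyz.2.2.2.2.2.2, ?_, ?_, ?_⟩ <;> simp; done)
      | (refine ⟨_, hxz.2.2.2.2.2.2, ?_, ?_, ?_⟩ <;> simp))
  obtain ⟨n, φ, hφ, rfl⟩ := X.exists_chart C hC
  change X.IsChart φ at hφ
  obtain ⟨β, rfl⟩ := hoC
  obtain ⟨βx, rfl⟩ : x ∈ Set.range φ := hSC (by simp)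
  obtain ⟨βy, rfl⟩ : y ∈ Set.range φ := hSC (by simp)
  obtain ⟨βz, rfl⟩ : z ∈ Set.range φ := hSC (by simp)
  obtain ⟨i, rfl⟩ := hφ.exists_update_of_adj hx
  obtain ⟨k, rfl⟩ := hφ.exists_update_of_adj hy
  obtain ⟨l, rfl⟩ := hφ.exists_update_of_adj hz
  have hik : i ≠ k := by rintro rfl; exact hxy.2.2.2.2.2.1 rfl
  have hkl : k ≠ l := by rintro rfl; exact hyz.2.2.2.2.2.1 rfl
  have hil : i ≠ l := by rintro rfl; exact hxz.2.2.2.2.2.1 rfl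
  -- A square is determined by three of its vertices, so the given squares are the coordinate
  -- squares at `β` in the cube supplied by the flag condition.
  have ha := hxy.rotate.rotate.rotate.eq_of_eq (hφ.isSquare_update β hik).rotate.rotate.rotate
  have hb := hyz.rotate.rotate.rotate.eq_of_eq (hφ.isSquare_update β hkl).rotate.rotate.rotate
  have hc := hxz.rotate.rotate.rotate.eq_of_eq (hφ.isSquare_update β hil).rotate.rotate.rotate
  have s1 := hφ.isSquare_update (Function.update β i (!β i)) hkl
  have s2 := hφ.isSquare_update (Function.update β k (!β k)) hil
  have s3 := hφ.isSquare_update (Function.update β l (!β l)) hik.symm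
  subst ha hb hc
  rw [← update_not_comm β hik] at s2
  rw [← update_not_comm β hil, ← update_not_comm β hkl] at s3
  refine ⟨_, s1, ?_, ?_⟩
  · exact s2
  · convert s3 using 2
    funext m
    simp only [Function.update_apply]
    grind

end Squares

/-! ### Reduced edge paths and their uniqueness up to flips. -/

section Flips

variable {V : Type*} (X : CubeComplex V)

/-- Edge paths are recorded as lists of vertices, the last vertex first. A flip pushes a path across
a square. -/
inductive Flip : List V → List V → Prop
  | square {a b c d : V} (l : List V) : X.IsSquare a b c d → Flip (c :: b :: a :: l) (c :: d :: a :: l)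
  | cons (v : V) {l l' : List V} : Flip l l' → Flip (v :: l) (v :: l')

/-- Two paths that differ by a sequence of flips. -/
def FlipEq : List V → List V → Prop := Relation.ReflTransGen X.Flip

/-- Deleting a backtrack. -/
inductive Cancel : List V → List V → Prop
  | here (a b : V) (l : List V) : Cancel (a :: b :: a :: l) (a :: l)
  | cons (v : V) {l l' : List V} : Cancel l l' → Cancel (v :: l) (v :: l')

/-- No sequence of flips creates a backtrack. -/
def Reduced (l : List V) : Prop := ∀ l' l'', X.FlipEq l l' → ¬ Cancel l' l''

variable {X}

lemma Flip.symm {l l' : List V} (h : X.Flip l l') : X.Flip l' l := by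
  induction h with
  | square l h => exact .square l h.reflect
  | cons v _ ih => exact .cons v ih

lemma FlipEq.refl (l : List V) : X.FlipEq l l := Relation.ReflTransGen.refl

lemma FlipEq.symm {l l' : List V} (h : X.FlipEq l l') : X.FlipEq l' l := by
  induction h with
  | refl => exact .refl _
  | tail _ h ih => exact Relation.ReflTransGen.head h.symm ih

lemma FlipEq.trans {l l' l'' : List V} (h : X.FlipEq l l') (h' : X.FlipEq l' l'') :
    X.FlipEq l l'' := Relation.ReflTransGen.trans h h'

lemma FlipEq.cons (v : V) {l l' : List V} (h : X.FlipEq l l') : X.FlipEq (v :: l) (v :: l') := by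
  induction h with
  | refl => exact .refl _
  | tail _ h ih => exact Relation.ReflTransGen.tail ih (.cons v h)

lemma IsSquare.flipEq {a b c d : V} (h : X.IsSquare a b c d) (l : List V) :
    X.FlipEq (c :: b :: a :: l) (c :: d :: a :: l) := Relation.ReflTransGen.single (.square l h)

lemma Flip.length_eq {l l' : List V} (h : X.Flip l l') : l.length = l'.length := by
  induction h with
  | square => rfl
  | cons v _ ih => simp [ih]

lemma FlipEq.length_eq {l l' : List V} (h : X.FlipEq l l') : l.length = l'.length := by
  induction h with
  | refl => rfl
  | tail _ h ih => rw [ih, h.length_eq]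

lemma Flip.head?_eq {l l' : List V} (h : X.Flip l l') : l.head? = l'.head? := by
  cases h <;> rfl

lemma FlipEq.head?_eq {l l' : List V} (h : X.FlipEq l l') : l.head? = l'.head? := by
  induction h with
  | refl => rfl
  | tail _ h ih => rw [ih, h.head?_eq]

lemma FlipEq.exists_cons {v : V} {l l' : List V} (h : X.FlipEq (v :: l) l') :
    ∃ p, l' = v :: p := by
  have := h.head?_eq
  cases l' with
  | nil => simp at this
  | cons w p => simp at this; exact ⟨p, by rw [this]⟩

lemma Reduced.of_flipEq {l l' : List V} (h : X.Reduced l) (hl : X.FlipEq l l') : X.Reduced l' :=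
  fun _ _ h1 => h _ _ (hl.trans h1)

lemma Reduced.of_cons {v : V} {l : List V} (h : X.Reduced (v :: l)) : X.Reduced l :=
  fun _ _ h1 h2 => h _ _ (h1.cons v) (.cons v h2)

/-- The possible relations between flip-equivalent paths `v :: w :: p` and `v :: w' :: p'`. -/
def Exchange (X : CubeComplex V) (v w : V) (p : List V) (w' : V) (p' : List V) : Prop :=
  (w = w' ∧ X.FlipEq (w :: p) (w' :: p')) ∨
    ∃ z q, X.IsSquare v w z w' ∧ X.FlipEq (w :: p) (w :: z :: q) ∧
      X.FlipEq (w' :: p') (w' :: z :: q)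

/-- When both relations come from squares, these share the edge from `v` to `w₁`, and the induction
hypothesis compares the two continuations below `w₁`. Equal continuations make the squares coincide.
Otherwise there is a third square at `w₁`, and the opposite faces of the resulting 3-cube provide
the square and the flips wanted. -/
lemma Exchange.trans (hX : X.IsNPC) {v w₀ w₁ w₂ : V} {p₀ p₁ p₂ : List V}
    (ih : ∀ z q z' q', q.length < p₁.length → X.FlipEq (w₁ :: z :: q) (w₁ :: z' :: q') →
      Exchange X w₁ z q z' q')
    (h₀ : Exchange X v w₀ p₀ w₁ p₁) (h₂ : Exchange X v w₁ p₁ w₂ p₂) :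
    Exchange X v w₀ p₀ w₂ p₂ := by
  rcases h₀ with ⟨rfl, h₀⟩ | ⟨z₀, q₀, s₀, h₀, h₀'⟩
  · rcases h₂ with ⟨rfl, h₂⟩ | ⟨z, q, s, h₂, h₂'⟩
    · exact .inl ⟨rfl, h₀.trans h₂⟩
    · exact .inr ⟨z, q, s, h₀.trans h₂, h₂'⟩
  · rcases h₂ with ⟨rfl, h₂⟩ | ⟨z, q, s, h₂, h₂'⟩
    · exact .inr ⟨z₀, q₀, s₀, h₀, h₂.symm.trans h₀'⟩
    · have hlen := h₀'.length_eq
      simp only [List.length_cons] at hlen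
      rcases ih z₀ q₀ z q (by omega) (h₀'.symm.trans h₂) with ⟨rfl, e⟩ | ⟨y, r, sq, e₀, e₂⟩
      · obtain rfl := s₀.reflect.eq_of_eq s
        exact .inl ⟨rfl, h₀.trans ((e.cons _).trans h₂'.symm)⟩
      · obtain ⟨t, t₁, t₂, t₃⟩ := hX.exists_opposite (o := w₁) (x := v) (y := z₀) (z := z)
          s₀.rotate.rotate.rotate sq s.flip
        refine .inr ⟨t, y :: r, t₁, ?_, ?_⟩
        · exact h₀.trans ((e₀.cons _).trans (t₂.rotate.rotate.rotate.flipEq r))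
        · exact h₂'.trans ((e₂.cons _).trans (t₃.flip.flipEq r))

lemma Flip.exchange {v w w' : V} {p p' : List V} (h : X.Flip (v :: w :: p) (v :: w' :: p')) :
    Exchange X v w p w' p' := by
  cases h with
  | square l hs => exact .inr ⟨_, l, hs.rotate.rotate.reflect, .refl _, .refl _⟩
  | cons _ h =>
    have := h.head?_eq
    simp only [List.head?_cons, Option.some.injEq] at this
    exact .inl ⟨this, Relation.ReflTransGen.single h⟩

/-- Flip-equivalent paths that end with different edges both pass, up to flips, through a square
containing these edges. -/
lemma FlipEq.exchange (hX : X.IsNPC) {v w w' : V} {p p' : List V}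
    (h : X.FlipEq (v :: w :: p) (v :: w' :: p')) : Exchange X v w p w' p' := by
  induction hn : p.length using Nat.strong_induction_on generalizing v w w' p p' with
  | _ n ih =>
    generalize hl : v :: w' :: p' = l at h
    -- The inner induction runs along the sequence of flips. A single flip is an exchange, and the
    -- outer induction on length supplies the comparison that transitivity needs.
    induction h generalizing w' p' with
    | refl =>
      simp only [List.cons.injEq, true_and] at hl
      obtain ⟨rfl, rfl⟩ := hl
      exact .inl ⟨rfl, .refl _⟩
    | @tail b c hb hbc ih' =>
      subst hl
      have hlen := FlipEq.length_eq hb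
      obtain ⟨b', rfl⟩ := FlipEq.exists_cons hb
      cases b' with
      | nil => simp at hlen
      | cons w₁ p₁ =>
        simp only [List.length_cons] at hlen
        exact (ih' rfl).trans hX
          (fun z q z' q' hq hz => ih q.length (by omega) hz rfl) hbc.exchange

/-- This is the analogue of the exchange condition in Coxeter groups: a step that destroys
reducedness retraces an edge with which the path can be made to end. A backtrack away from the end
is handled by induction on the remainder beyond the exchanged square. -/
lemma Reduced.exists_of_not_reduced_cons (hX : X.IsNPC) {v w : V} {p : List V}
    (h : X.Reduced (v :: p)) (h' : ¬ X.Reduced (w :: v :: p)) :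
    ∃ q, X.FlipEq (v :: p) (v :: w :: q) := by
  induction hn : p.length using Nat.strong_induction_on generalizing v w p with
  | _ n ih =>
    simp only [Reduced, not_forall, not_not] at h'
    obtain ⟨l', l'', hl', hc⟩ := h'
    cases hc with
    | here a b B =>
      obtain ⟨_, hw⟩ := hl'.exists_cons
      obtain ⟨rfl, rfl⟩ := List.cons.inj hw
      rcases hl'.exchange hX with ⟨rfl, h1⟩ | ⟨z, q, s, h1, h2⟩
      · exact ⟨B, h1⟩
      · rcases h2.exchange hX with ⟨rfl, -⟩ | ⟨z', q', s', -, h4⟩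
        · exact absurd rfl s.2.2.2.2.1
        · obtain rfl := s.reflect.eq_of_eq s'.flip
          exact absurd (.here _ _ _) (h _ _ (h1.trans (h4.cons _)))
    | @cons v₀ l₁ l₁' hc =>
      obtain ⟨_, hw⟩ := hl'.exists_cons
      obtain ⟨rfl, rfl⟩ := List.cons.inj hw
      cases l₁ with
      | nil => exact absurd hl'.length_eq (by simp)
      | cons v' p' =>
        rcases hl'.exchange hX with ⟨rfl, h1⟩ | ⟨z, q, s, h1, h2⟩
        · exact absurd hc (h _ _ h1)
        · have hq : X.Reduced (z :: q) := (h.of_flipEq h1).of_cons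
          have hlen := h1.length_eq
          simp only [List.length_cons] at hlen
          obtain ⟨q'', h3⟩ := ih q.length (by omega) (w := v') hq
            (fun hr => hr _ _ h2.symm hc) rfl
          exact ⟨v' :: q'', h1.trans ((h3.cons _).trans (s.rotate.rotate.flip.flipEq _))⟩

/-- `t` is the reduced path from the common origin to `w` that corresponds to the reduced path `s`
to `v` followed by an edge from `v` to `w`. -/
def Ext (X : CubeComplex V) (v w : V) (s t : List V) : Prop :=
  (∃ p, s = v :: p) ∧ (∃ q, t = w :: q) ∧
    ((X.FlipEq t (w :: s) ∧ X.Reduced t) ∨ (X.FlipEq s (v :: t) ∧ X.Reduced s))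

lemma Ext.symm {v w : V} {s t : List V} (h : Ext X v w s t) : Ext X w v t s :=
  ⟨h.2.1, h.1, h.2.2.symm⟩

lemma Ext.congr {v w : V} {s t s' t' : List V} (h : Ext X v w s t) (hs : X.FlipEq s s')
    (ht : X.FlipEq t t') : Ext X v w s' t' := by
  obtain ⟨⟨p, rfl⟩, ⟨q, rfl⟩, h⟩ := h
  refine ⟨hs.exists_cons, ht.exists_cons, ?_⟩
  rcases h with ⟨h1, h2⟩ | ⟨h1, h2⟩
  · exact .inl ⟨ht.symm.trans (h1.trans (hs.cons _)), h2.of_flipEq ht⟩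
  · exact .inr ⟨hs.symm.trans (h1.trans (ht.cons _)), h2.of_flipEq hs⟩

lemma Ext.reduced_right {v w : V} {s t : List V} (h : Ext X v w s t) : X.Reduced t := by
  rcases h.2.2 with ⟨-, h⟩ | ⟨h1, h⟩
  · exact h
  · exact (h.of_flipEq h1).of_cons

lemma Ext.reduced_left {v w : V} {s t : List V} (h : Ext X v w s t) : X.Reduced s :=
  h.symm.reduced_right

/-- If one extension lengthens the path and the other shortens it, the longer one flips to a path
with a backtrack. If both shorten it, the square alternative of the exchange would have two equal
opposite corners. -/
lemma Ext.unique (hX : X.IsNPC) {v w : V} {s t t' : List V} (h : Ext X v w s t)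
    (h' : Ext X v w s t') : X.FlipEq t t' := by
  obtain ⟨⟨p, rfl⟩, ⟨q, rfl⟩, h⟩ := h
  obtain ⟨-, ⟨q', rfl⟩, h'⟩ := h'
  rcases h with ⟨h1, h2⟩ | ⟨h1, h2⟩ <;> rcases h' with ⟨h1', h2'⟩ | ⟨h1', h2'⟩
  · exact h1.trans h1'.symm
  · exact absurd (.here _ _ _) (h2 _ _ (h1.trans (h1'.cons _)))
  · exact absurd (.here _ _ _) (h2' _ _ (h1'.trans (h1.cons _)))
  · rcases (h1.symm.trans h1').exchange hX with ⟨-, h⟩ | ⟨z, q, s, -, -⟩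
    · exact h
    · exact absurd rfl s.2.2.2.2.2.1

/-- The cases record whether each of the two steps lengthens or shortens the path. Two steps in the
same direction are flipped directly across the square; in the mixed cases any square produced by an
exchange must be the given one. -/
lemma Ext.square (hX : X.IsNPC) {a b c d : V} (hs : X.IsSquare a b c d) {s t t' : List V}
    (h : Ext X a b s t) (h' : Ext X b c t t') : ∃ r, Ext X a d s r ∧ Ext X d c r t' := by
  have hsr := h.reduced_left
  have htr' := h'.reduced_right
  obtain ⟨⟨p, rfl⟩, ⟨q, rfl⟩, h⟩ := h
  obtain ⟨-, ⟨q', rfl⟩, h'⟩ := h'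
  rcases h with ⟨h1, h2⟩ | ⟨h1, h2⟩ <;> rcases h' with ⟨h1', h2'⟩ | ⟨h1', h2'⟩
  · have e : X.FlipEq (c :: q') (c :: d :: a :: p) :=
      h1'.trans ((h1.cons _).trans (hs.flipEq p))
    exact ⟨d :: a :: p, ⟨⟨_, rfl⟩, ⟨_, rfl⟩, .inl ⟨.refl _, (h2'.of_flipEq e).of_cons⟩⟩,
      ⟨_, rfl⟩, ⟨_, rfl⟩, .inl ⟨e, h2'⟩⟩
  · rcases (h1.symm.trans h1').exchange hX with ⟨rfl, -⟩ | ⟨z, r, s, e1, e2⟩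
    · exact absurd rfl hs.2.2.2.2.1
    · obtain rfl := s.flip.eq_of_eq hs
      exact ⟨z :: r, ⟨⟨_, rfl⟩, ⟨_, rfl⟩, .inr ⟨e1, hsr⟩⟩, ⟨_, rfl⟩, ⟨_, rfl⟩, .inl ⟨e2, htr'⟩⟩
  · by_cases hr : X.Reduced (d :: a :: p)
    · refine ⟨d :: a :: p, ⟨⟨_, rfl⟩, ⟨_, rfl⟩, .inl ⟨.refl _, hr⟩⟩, ⟨_, rfl⟩, ⟨_, rfl⟩, .inr ⟨?_, hr⟩⟩
      exact (h1.cons _).trans ((hs.rotate.flipEq q).symm.trans (h1'.symm.cons _))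
    · obtain ⟨r, hr⟩ := hsr.exists_of_not_reduced_cons hX hr
      rcases (h1.symm.trans hr).exchange hX with ⟨rfl, -⟩ | ⟨z, r', s, e1, -⟩
      · exact absurd rfl hs.2.2.2.2.2.1
      · obtain rfl := s.rotate.rotate.rotate.eq_of_eq hs.rotate.rotate.rotate
        exact absurd (.here _ _ _) (h2' _ _ (h1'.trans (e1.cons _)))
  · have e : X.FlipEq (a :: p) (a :: d :: c :: q') :=
      h1.trans ((h1'.cons _).trans (hs.rotate.rotate.reflect.flipEq _))
    exact ⟨d :: c :: q', ⟨⟨_, rfl⟩, ⟨_, rfl⟩, .inr ⟨e, hsr⟩⟩, ⟨_, rfl⟩, ⟨_, rfl⟩,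
      .inr ⟨.refl _, (hsr.of_flipEq e).of_cons⟩⟩

lemma Reduced.exists_ext (hX : X.IsNPC) {v : V} (w : V) {p : List V} (h : X.Reduced (v :: p)) :
    ∃ t, Ext X v w (v :: p) t := by
  by_cases hr : X.Reduced (w :: v :: p)
  · exact ⟨_, ⟨_, rfl⟩, ⟨_, rfl⟩, .inl ⟨.refl _, hr⟩⟩
  · obtain ⟨q, hq⟩ := h.exists_of_not_reduced_cons hX hr
    exact ⟨w :: q, ⟨_, rfl⟩, ⟨_, rfl⟩, .inr ⟨hq, h⟩⟩

/-- The effect on reduced paths of extending them along a walk. -/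
def Track (X : CubeComplex V) : ∀ {a b : V}, X.graph.Walk a b → List V → List V → Prop
  | a, _, .nil => fun s t => (∃ p, s = a :: p) ∧ X.Reduced s ∧ X.FlipEq s t
  | _, _, .cons (u := u) (v := v) _ q => fun s t => ∃ s', Ext X u v s s' ∧ Track X q s' t

lemma Track.congr {a b : V} {p : X.graph.Walk a b} {s s' t t' : List V} (h : Track X p s t)
    (hs : X.FlipEq s s') (ht : X.FlipEq t t') : Track X p s' t' := by
  induction p generalizing s s' with
  | nil =>
    obtain ⟨⟨q, rfl⟩, h1, h2⟩ := h
    exact ⟨hs.exists_cons, h1.of_flipEq hs, hs.symm.trans (h2.trans ht)⟩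
  | cons _ q ih =>
    obtain ⟨r, h1, h2⟩ := h
    exact ⟨r, h1.congr hs (.refl _), ih h2 (.refl _)⟩

lemma Track.start {a b : V} {p : X.graph.Walk a b} {s t : List V} (h : Track X p s t) :
    (∃ q, s = a :: q) ∧ X.Reduced s := by
  cases p with
  | nil => exact ⟨h.1, h.2.1⟩
  | cons _ _ =>
    obtain ⟨r, h1, h2⟩ := h
    exact ⟨h1.1, h1.reduced_left⟩

lemma Track.append {a b c : V} {p : X.graph.Walk a b} {q : X.graph.Walk b c} {s r t : List V}
    (h : Track X p s r) (h' : Track X q r t) : Track X (p.append q) s t := by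
  induction p generalizing s with
  | nil => exact h'.congr h.2.2.symm (.refl _)
  | cons _ p ih =>
    obtain ⟨s', h1, h2⟩ := h
    exact ⟨s', h1, ih h2 h'⟩

lemma Track.of_append {a b c : V} {p : X.graph.Walk a b} {q : X.graph.Walk b c} {s t : List V}
    (h : Track X (p.append q) s t) : ∃ r, Track X p s r ∧ Track X q r t := by
  induction p generalizing s with
  | nil => exact ⟨s, ⟨h.start.1, h.start.2, .refl _⟩, h⟩
  | cons _ p ih =>
    obtain ⟨s', h1, h2⟩ := h
    obtain ⟨r, h3, h4⟩ := ih h2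
    exact ⟨r, ⟨s', h1, h3⟩, h4⟩

lemma Ext.track {v w : V} (h : X.graph.Adj v w) {s t : List V} (hst : Ext X v w s t) :
    Track X (.cons h .nil) s t :=
  ⟨t, hst, hst.2.1, hst.reduced_right, .refl _⟩

lemma Track.reverse {a b : V} {p : X.graph.Walk a b} {s t : List V} (h : Track X p s t) :
    Track X p.reverse t s := by
  induction p generalizing s with
  | nil =>
    obtain ⟨⟨q, rfl⟩, h1, h2⟩ := h
    exact ⟨h2.exists_cons, h1.of_flipEq h2, h2.symm⟩
  | cons hadj p ih =>
    obtain ⟨r, h1, h2⟩ := h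
    rw [SimpleGraph.Walk.reverse_cons]
    exact (ih h2).append (h1.symm.track _)

/-- A backtrack acts trivially because extensions exist, are unique and are symmetric; a square acts
trivially by `Ext.square`. -/
lemma ElementaryHomotopy.track_iff (hX : X.IsNPC) {u v : V} {p q : X.graph.Walk u v}
    (h : X.ElementaryHomotopy p q) (s t : List V) : Track X p s t ↔ Track X q s t := by
  cases h with
  | backtrack p hadj q =>
    constructor
    · intro h
      obtain ⟨r, h1, r', h2, r'', h3, h4⟩ := h.of_append
      exact h1.append (h4.congr (h3.unique hX h2.symm) (.refl _))
    · intro h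
      obtain ⟨r, h1, h2⟩ := h.of_append
      obtain ⟨⟨r', rfl⟩, hr⟩ := h2.start
      obtain ⟨r'', h3⟩ := hr.exists_ext hX _
      exact h1.append ⟨r'', h3, _, h3.symm, h2⟩
  | square p q hab hbc had hdc hs =>
    constructor
    · intro h
      obtain ⟨r, h1, r', h2, r'', h3, h4⟩ := h.of_append
      obtain ⟨x, h5, h6⟩ := Ext.square hX hs h2 h3
      exact h1.append ⟨x, h5, r'', h6, h4⟩
    · intro h
      obtain ⟨r, h1, r', h2, r'', h3, h4⟩ := h.of_append
      obtain ⟨x, h5, h6⟩ := Ext.square hX hs.reflect h2 h3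
      exact h1.append ⟨x, h5, r'', h6, h4⟩

lemma Reduced.exists_track {l : List V} (hl : X.Reduced l) (hc : l.IsChain X.Adj) {u v : V}
    (hv : l.head? = some v) (hu : l.getLast? = some u) :
    ∃ p : X.graph.Walk u v, Track X p [u] l := by
  induction l generalizing v with
  | nil => simp at hv
  | cons w l ih =>
    obtain rfl : w = v := by simpa using hv
    cases l with
    | nil =>
      obtain rfl : w = u := by simpa using hu
      exact ⟨.nil, ⟨_, rfl⟩, hl, .refl _⟩
    | cons v' p =>
      rw [List.isChain_cons_cons] at hc
      obtain ⟨q, hq⟩ := ih hl.of_cons hc.2 (v := v') rfl (by simpa using hu)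
      exact ⟨q.append (.cons hc.1.symm .nil), hq.append
        (Ext.track _ ⟨⟨_, rfl⟩, ⟨_, rfl⟩, .inl ⟨.refl _, hl⟩⟩)⟩

/-- In a CAT(0) cube complex, reduced paths with the same ends differ by flips. -/
theorem Reduced.flipEq (hX : X.IsCAT0) {l l' : List V} (hl : X.Reduced l) (hl' : X.Reduced l')
    (hc : l.IsChain X.Adj) (hc' : l'.IsChain X.Adj) (hne : l ≠ [])
    (hhead : l.head? = l'.head?) (hlast : l.getLast? = l'.getLast?) : X.FlipEq l l' := by
  obtain ⟨v, hv⟩ : ∃ v, l.head? = some v := by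
    cases l with
    | nil => exact absurd rfl hne
    | cons v _ => exact ⟨v, rfl⟩
  obtain ⟨u, hu⟩ : ∃ u, l.getLast? = some u := ⟨_, List.getLast?_eq_some_getLast hne⟩
  obtain ⟨p, hp⟩ := hl.exists_track hc hv hu
  obtain ⟨p', hp'⟩ := hl'.exists_track hc' (hhead ▸ hv) (hlast ▸ hu)
  -- The loop that runs back along `l` and out along `l'` carries `l` to `l'`. It is null-homotopic,
  -- and the constant path relates only flip-equivalent paths.
  have key : ∀ q r : X.graph.Walk v v, Relation.EqvGen X.ElementaryHomotopy q r →
      (Track X q l l' ↔ Track X r l l') := by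
    intro q r h
    induction h with
    | rel _ _ h => exact h.track_iff hX.1 _ _
    | refl _ => exact Iff.rfl
    | symm _ _ _ ih => exact ih.symm
    | trans _ _ _ _ _ ih₁ ih₂ => exact ih₁.trans ih₂
  exact ((key _ _ (hX.2.2 v (p.reverse.append p'))).1 (hp.reverse.append hp')).2.2

end Flips

end CubeComplex

namespace CubeComplex

/-! ### Reducing paths by flips and cancellations. -/

section Reduction

variable {V : Type*} {X : CubeComplex V}

lemma Flip.getLast?_eq {l l' : List V} (h : X.Flip l l') : l.getLast? = l'.getLast? := by
  induction h with
  | square => simp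
  | cons v h ih =>
    cases h <;> simp_all

lemma FlipEq.getLast?_eq {l l' : List V} (h : X.FlipEq l l') : l.getLast? = l'.getLast? := by
  induction h with
  | refl => rfl
  | tail _ h ih => rw [ih, h.getLast?_eq]

lemma Cancel.getLast?_eq {l l' : List V} (h : Cancel l l') : l.getLast? = l'.getLast? := by
  induction h with
  | here => simp
  | cons v h ih =>
    cases h <;> simp_all

lemma Cancel.head?_eq {l l' : List V} (h : Cancel l l') : l.head? = l'.head? := by
  cases h <;> rfl

lemma Cancel.length_eq {l l' : List V} (h : Cancel l l') : l.length = l'.length + 2 := by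
  induction h with
  | here => rfl
  | cons v _ ih => simp only [List.length_cons]; omega

lemma Cancel.append_right {l l' : List V} (h : Cancel l l') (r : List V) :
    Cancel (l ++ r) (l' ++ r) := by
  induction h with
  | here a b l => exact .here a b _
  | cons v _ ih => exact .cons v ih

lemma Flip.append_right {l l' : List V} (h : X.Flip l l') (r : List V) :
    X.Flip (l ++ r) (l' ++ r) := by
  induction h with
  | square l h => exact .square _ h
  | cons v _ ih => exact .cons v ih

lemma FlipEq.append_right {l l' : List V} (h : X.FlipEq l l') (r : List V) :
    X.FlipEq (l ++ r) (l' ++ r) := by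
  induction h with
  | refl => exact .refl _
  | tail _ h ih => exact Relation.ReflTransGen.tail ih (h.append_right r)

lemma Reduced.of_append_right {l r : List V} (h : X.Reduced (l ++ r)) : X.Reduced l :=
  fun _ _ h1 h2 => h _ _ (h1.append_right r) (h2.append_right r)

lemma reduced_of_length_lt_three {l : List V} (h : l.length < 3) : X.Reduced l := by
  intro l' l'' h1 h2
  have := h1.length_eq
  cases h2 with
  | here => simp at this; omega
  | cons _ h2 =>
    cases h2 with
    | here => simp at this; omega
    | cons _ h2 =>
      cases h2 <;> simp at this <;> omega

lemma reduced_triple {a b c : V} (h : a ≠ c) : X.Reduced [a, b, c] := by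
  intro l' l'' h1 h2
  have hl := h1.length_eq
  have hh := h1.head?_eq
  have ht := h1.getLast?_eq
  cases h2 with
  | here a' b' l =>
    cases l with
    | nil => simp at hh ht; exact h (hh.trans ht.symm)
    | cons => simp at hl
  | cons _ h2 =>
    have := h2.length_eq
    simp only [List.length_cons, List.length_nil] at hl
    cases h2 with
    | here => simp at hl
    | cons _ h2 => cases h2 <;> simp_all

/-- A property of paths given by a relation on consecutive vertices that is compatible with squares
is preserved by flips. -/
lemma Flip.isChain {r : V → V → Prop}
    (hr : ∀ a b c d, X.IsSquare a b c d → r c b → r b a → r c d ∧ r d a)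
    {l l' : List V} (h : X.Flip l l') (hl : l.IsChain r) : l'.IsChain r := by
  induction h with
  | square l hs =>
    simp only [List.isChain_cons_cons] at hl ⊢
    obtain ⟨h1, h2⟩ := hr _ _ _ _ hs hl.1 hl.2.1
    exact ⟨h1, h2, hl.2.2⟩
  | cons v h ih =>
    rw [List.isChain_cons] at hl ⊢
    rw [← h.head?_eq]
    exact ⟨hl.1, ih hl.2⟩

lemma FlipEq.isChain {r : V → V → Prop}
    (hr : ∀ a b c d, X.IsSquare a b c d → r c b → r b a → r c d ∧ r d a)
    {l l' : List V} (h : X.FlipEq l l') (hl : l.IsChain r) : l'.IsChain r := by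
  induction h with
  | refl => exact hl
  | tail _ h ih => exact h.isChain hr ih

lemma Cancel.isChain {r : V → V → Prop} {l l' : List V} (h : Cancel l l') (hl : l.IsChain r) :
    l'.IsChain r := by
  induction h with
  | here a b l =>
    rw [List.isChain_cons_cons, List.isChain_cons_cons] at hl
    exact hl.2.2
  | cons v h ih =>
    rw [List.isChain_cons] at hl ⊢
    rw [← h.head?_eq]
    exact ⟨hl.1, ih hl.2⟩

/-- Every property of paths that is stable under flips and cancellations passes to some reduced
path. -/
lemma exists_reduced {p : List V → Prop} (hflip : ∀ l l', X.Flip l l' → p l → p l')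
    (hcancel : ∀ l l', Cancel l l' → p l → p l') (l : List V) (hl : p l) :
    ∃ r, X.Reduced r ∧ p r := by
  induction hn : l.length using Nat.strong_induction_on generalizing l with
  | _ n ih =>
    by_cases hr : X.Reduced l
    · exact ⟨l, hr, hl⟩
    · simp only [Reduced, not_forall, not_not] at hr
      obtain ⟨l', l'', h1, h2⟩ := hr
      have hp : p l' := by
        clear h2
        induction h1 with
        | refl => exact hl
        | tail _ h ih => exact hflip _ _ h ih
      have e1 := h1.length_eq
      have e2 := h2.length_eq
      exact ih l''.length (by omega) l'' (hcancel _ _ h2 hp) rfl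

end Reduction

/-! ### Ladders of squares, and how reduced paths cross walls. -/

section Ladders

variable {V : Type*} {X : CubeComplex V}

variable (X) in
/-- Two parallel paths that are joined by a sequence of squares. -/
inductive Ladder : List V → List V → Prop
  | single {x y : V} : X.Adj x y → Ladder [x] [y]
  | cons {x x' y y' : V} {l m : List V} : X.IsSquare x' x y y' → Ladder (x :: l) (y :: m) →
      Ladder (x' :: x :: l) (y' :: y :: m)

lemma Ladder.exists_cons {l m : List V} (h : X.Ladder l m) :
    ∃ x l' y m', l = x :: l' ∧ m = y :: m' ∧ X.Adj x y := by
  cases h with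
  | single h => exact ⟨_, _, _, _, rfl, rfl, h⟩
  | cons h _ => exact ⟨_, _, _, _, rfl, rfl, h.2.2.2.1.symm⟩

lemma Ladder.isChain {l m : List V} (h : X.Ladder l m) : l.IsChain X.Adj := by
  induction h with
  | single => simp
  | cons hs _ ih => exact List.isChain_cons_cons.2 ⟨hs.1, ih⟩

/-- The flipped square and the two squares of the ladder beside it span a 3-cube, whose remaining
faces continue the ladder along the new path. -/
lemma Ladder.flip (hX : X.IsNPC) {l l' m : List V} (h : X.Ladder l m) (hl : X.Flip l l') :
    ∃ m', X.Ladder l' m' ∧ m'.head? = m.head? ∧ m'.getLast? = m.getLast? := by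
  induction hl generalizing m with
  | square l hs =>
    cases h with
    | cons h1 h =>
      cases h with
      | cons h2 h =>
        obtain ⟨t, t1, t2, t3⟩ := hX.exists_opposite hs.flip h1.flip h2
        exact ⟨_, .cons t2 (.cons t1.flip h), rfl, by simp⟩
  | cons v hl ih =>
    cases h with
    | single => cases hl
    | cons hs h =>
      obtain ⟨m', h1, h2, h3⟩ := ih h
      obtain ⟨x, l', y, m'', rfl, rfl, -⟩ := h1.exists_cons
      have := hl.head?_eq
      simp only [List.head?_cons, Option.some.injEq] at h2 this
      subst h2 this
      exact ⟨_, .cons hs h1, rfl, by simpa using h3⟩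

lemma Ladder.flipEq (hX : X.IsNPC) {l l' m : List V} (h : X.Ladder l m) (hl : X.FlipEq l l') :
    ∃ m', X.Ladder l' m' ∧ m'.head? = m.head? ∧ m'.getLast? = m.getLast? := by
  induction hl with
  | refl => exact ⟨m, h, rfl, rfl⟩
  | tail _ hl ih =>
    obtain ⟨m', h1, h2, h3⟩ := ih
    obtain ⟨m'', h1', h2', h3'⟩ := h1.flip hX hl
    exact ⟨m'', h1', h2'.trans h2, h3'.trans h3⟩

/-- The two squares over a backtrack share three vertices, so they coincide and the opposite path
backtracks too. -/
lemma Ladder.cancel {l l' m : List V} (h : X.Ladder l m) (hl : Cancel l l') :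
    ∃ m', X.Ladder l' m' ∧ m'.head? = m.head? ∧ m'.getLast? = m.getLast? := by
  induction hl generalizing m with
  | here a b l =>
    cases h with
    | cons h1 h =>
      cases h with
      | cons h2 h =>
        obtain rfl := h1.eq_of_eq h2.flip
        exact ⟨_, h, rfl, by simp⟩
  | cons v hl ih =>
    cases h with
    | single => cases hl
    | cons hs h =>
      obtain ⟨m', h1, h2, h3⟩ := ih h
      obtain ⟨x, l', y, m'', rfl, rfl, -⟩ := h1.exists_cons
      have := hl.head?_eq
      simp only [List.head?_cons, Option.some.injEq] at h2 this
      subst h2 this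
      exact ⟨_, .cons hs h1, rfl, by simpa using h3⟩

lemma Ladder.exists_reduced (hX : X.IsNPC) {l m : List V} (h : X.Ladder l m) :
    ∃ l' m', X.Ladder l' m' ∧ X.Reduced l' ∧ l'.head? = l.head? ∧ l'.getLast? = l.getLast? ∧
      m'.head? = m.head? ∧ m'.getLast? = m.getLast? := by
  obtain ⟨r, hr, ⟨m', h1, h2, h3⟩, h4, h5⟩ := CubeComplex.exists_reduced (X := X)
    (p := fun r => (∃ m', X.Ladder r m' ∧ m'.head? = m.head? ∧ m'.getLast? = m.getLast?) ∧
      r.head? = l.head? ∧ r.getLast? = l.getLast?)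
    (by
      rintro r r' hr ⟨⟨m', h1, h2, h3⟩, h4, h5⟩
      obtain ⟨m'', h1', h2', h3'⟩ := h1.flip hX hr
      exact ⟨⟨m'', h1', h2'.trans h2, h3'.trans h3⟩, hr.head?_eq ▸ h4, hr.getLast?_eq ▸ h5⟩)
    (by
      rintro r r' hr ⟨⟨m', h1, h2, h3⟩, h4, h5⟩
      obtain ⟨m'', h1', h2', h3'⟩ := h1.cancel hr
      exact ⟨⟨m'', h1', h2'.trans h2, h3'.trans h3⟩, hr.head?_eq ▸ h4, hr.getLast?_eq ▸ h5⟩)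
    l ⟨⟨m, h, rfl, rfl⟩, rfl, rfl⟩
  exact ⟨r, m', h1, hr, h4, h5, h2, h3⟩

/-- The rung at the origin is pushed through the squares, one flip each, to the other end of the
ladder. -/
lemma Ladder.flipEq_append {x y z : V} {l m : List V} (h : X.Ladder (x :: l) (y :: m))
    (hz : (y :: m).getLast? = some z) : X.FlipEq (x :: l ++ [z]) (x :: y :: m) := by
  induction l generalizing x y m with
  | nil =>
    cases h with
    | single =>
      obtain rfl : y = z := by simpa using hz
      exact .refl _
  | cons x' l ih =>
    cases h with
    | @cons _ _ y' _ _ m hs h =>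
      exact ((ih h (by simpa using hz)).cons _).trans (hs.rotate.rotate.reflect.flipEq _)

lemma IsSquare.wall_eq {a b c d : V} (hs : X.IsSquare a b c d) {e f : X.Edge} (he : e.1 = {a, b})
    (hf : f.1 = {d, c}) : X.wall e = X.wall f :=
  Quotient.sound (Relation.EqvGen.rel _ _ ⟨a, b, c, d, hs, he, hf⟩)

/-- The edge with ends `x` and `y`. -/
def Adj.edge {x y : V} (h : X.Adj x y) : X.Edge := ⟨{x, y}, x, y, h, rfl⟩

lemma Edge.adj (e : X.Edge) {x y : V} (h : e.1 = {x, y}) : X.Adj x y := by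
  obtain ⟨a, b, hab, he⟩ := e.2
  rw [h, Set.pair_eq_pair_iff] at he
  rcases he with ⟨rfl, rfl⟩ | ⟨rfl, rfl⟩
  · exact hab
  · exact hab.symm

lemma Opposite.symm {e f : X.Edge} (h : X.Opposite e f) : X.Opposite f e := by
  obtain ⟨a, b, c, d, hs, he, hf⟩ := h
  exact ⟨d, c, b, a, hs.reflect.rotate, hf, he⟩

lemma reflTransGen_opposite_of_wall_eq {e f : X.Edge} (h : X.wall e = X.wall f) :
    Relation.ReflTransGen X.Opposite e f := by
  have hsymm : Std.Symm X.Opposite := ⟨fun _ _ => Opposite.symm⟩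
  have : Relation.EqvGen X.Opposite e f := Quotient.exact h
  clear h
  induction this with
  | rel _ _ h => exact .single h
  | refl _ => exact .refl
  | symm _ _ _ ih => exact Relation.ReflTransGen.stdSymm.symm _ _ ih
  | trans _ _ _ _ _ ih₁ ih₂ => exact ih₁.trans ih₂

/-- Each opposition of edges adds one square to the ladder. The orientation in which the last rung
meets `f` is not under control. -/
lemma exists_ladder_of_wall_eq {e f : X.Edge} (h : X.wall e = X.wall f) {x y : V}
    (he : e.1 = {x, y}) : ∃ x' y' l m, f.1 = {x', y'} ∧ X.Ladder (x' :: l) (y' :: m) ∧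
      (x' :: l).getLast? = some x ∧ (y' :: m).getLast? = some y := by
  have := reflTransGen_opposite_of_wall_eq h
  clear h
  induction this with
  | refl => exact ⟨x, y, [], [], he, .single (e.adj he), rfl, rfl⟩
  | tail _ h ih =>
    obtain ⟨x', y', l, m, h1, h2, h3, h4⟩ := ih
    obtain ⟨a, b, c, d, hs, ha, hd⟩ := h
    rw [h1, Set.pair_eq_pair_iff] at ha
    rcases ha with ⟨rfl, rfl⟩ | ⟨rfl, rfl⟩
    · exact ⟨d, c, _, _, hd, .cons hs.rotate.rotate.rotate h2, by simpa using h3, by simpa using h4⟩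
    · exact ⟨c, d, _, _, by rw [hd, Set.pair_comm],
        .cons hs.flip.rotate.rotate.rotate h2, by simpa using h3, by simpa using h4⟩

/-- A reduced path crosses every wall at most once. -/
theorem wall_ne_of_reduced (hX : X.IsCAT0) {x y x₀ y₀ : V} {M : List V}
    (hr : X.Reduced (y :: (M ++ [y₀]))) (hc : (y :: (M ++ [y₀])).IsChain X.Adj)
    (hx : M.head? = some x) (hx₀ : M.getLast? = some x₀) {e f : X.Edge} (he : e.1 = {x, y})
    (hf : f.1 = {x₀, y₀}) : X.wall e ≠ X.wall f := by
  intro hw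
  obtain ⟨M, rfl⟩ : ∃ M', M = x :: M' := by
    cases M with
    | nil => simp at hx
    | cons a M' => exact ⟨M', by simpa using hx⟩
  obtain ⟨x', y', l, m, h1, h2, h3, h4⟩ := exists_ladder_of_wall_eq hw.symm hf
  obtain ⟨r, m', hrm, hred, e1, e2, e3, e4⟩ := h2.exists_reduced hX.1
  have hM : X.Reduced (y :: x :: M) :=
    Reduced.of_append_right (l := y :: x :: M) (r := [y₀]) hr
  have hcM : (y :: x :: M).IsChain X.Adj :=
    List.IsChain.left_of_append (l₁ := y :: x :: M) (l₂ := [y₀]) hc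
  rw [he, Set.pair_eq_pair_iff] at h1
  rcases h1 with ⟨rfl, rfl⟩ | ⟨rfl, rfl⟩
  -- The ladder can be carried over to the rail `x :: M`. Pushing the rung `{x₀, y₀}` to the end of
  -- the path then creates the backtrack `y`, `x`, `y`.
  · have hflip := hred.flipEq hX hM.of_cons hrm.isChain (List.isChain_cons_cons.1 hcM).2
      (by rintro rfl; simp at e1) (by rw [e1]; rfl) (by rw [e2, h3, hx₀])
    obtain ⟨m'', h5, h6, h7⟩ := hrm.flipEq hX.1 hflip
    obtain ⟨_, _, y'', m'', h8, rfl, -⟩ := h5.exists_cons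
    obtain rfl : y'' = y := by simpa using h6.trans e3
    refine hr _ _ ((h5.flipEq_append (z := y₀) ?_).cons _) (.here _ _ _)
    rw [h7, e4, h4]
  -- With the opposite orientation the rail is `y :: x :: M`. The vertex across from `y` is `x`, so
  -- the last square would have two equal opposite corners.
  · have hflip := hred.flipEq hX hM hrm.isChain hcM
      (by rintro rfl; simp at e1) (by rw [e1]; rfl) (by rw [e2, h3, ← hx₀]; simp)
    obtain ⟨m'', h5, h6, h7⟩ := hrm.flipEq hX.1 hflip
    cases h5 with
    | @cons _ _ _ z _ _ hs h5 =>
      have : z = x := by simpa using h6.trans e3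
      exact hs.2.2.2.2.2.1 this.symm

/-- Adjacent edges of a square are dual to different walls. -/
lemma IsSquare.wall_ne (hX : X.IsCAT0) {a b c d : V} (hs : X.IsSquare a b c d) {e f : X.Edge}
    (he : e.1 = {a, b}) (hf : f.1 = {b, c}) : X.wall e ≠ X.wall f :=
  wall_ne_of_reduced hX (M := [b]) (reduced_triple hs.2.2.2.2.1)
    (by simp [hs.1, hs.2.1]) rfl rfl (by rw [he, Set.pair_comm]) hf

/-- Consecutive vertices of the path are joined by edges that do not cross `W`. -/
def Wall.Avoids (W : X.Wall) (l : List V) : Prop :=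
  l.IsChain fun u v => ∃ e : X.Edge, e.1 = {u, v} ∧ X.wall e ≠ W

lemma Wall.avoids_square (W : X.Wall) (a b c d : V) (hs : X.IsSquare a b c d)
    (h1 : ∃ e : X.Edge, e.1 = {c, b} ∧ X.wall e ≠ W) (h2 : ∃ e : X.Edge, e.1 = {b, a} ∧ X.wall e ≠ W) :
    (∃ e : X.Edge, e.1 = {c, d} ∧ X.wall e ≠ W) ∧ ∃ e : X.Edge, e.1 = {d, a} ∧ X.wall e ≠ W := by
  obtain ⟨e, he, heW⟩ := h1
  obtain ⟨f, hf, hfW⟩ := h2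
  refine ⟨⟨hs.2.2.1.edge, rfl, ?_⟩, ⟨hs.2.2.2.1.edge, rfl, ?_⟩⟩
  · rwa [← IsSquare.wall_eq hs.flip hf (show hs.2.2.1.edge.1 = {c, d} from rfl)]
  · rwa [← IsSquare.wall_eq hs.rotate.flip he (show hs.2.2.2.1.edge.1 = {d, a} from rfl)]

lemma Wall.SameSide.symm {W : X.Wall} {x y : V} (h : W.SameSide x y) : W.SameSide y x :=
  have : Std.Symm fun u v => ∃ e : X.Edge, e.1 = {u, v} ∧ X.wall e ≠ W :=
    ⟨fun _ _ ⟨e, he, hw⟩ => ⟨e, by rw [he, Set.pair_comm], hw⟩⟩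
  Relation.ReflTransGen.stdSymm.symm _ _ h

lemma Wall.SameSide.trans {W : X.Wall} {x y z : V} (h : W.SameSide x y) (h' : W.SameSide y z) :
    W.SameSide x z := Relation.ReflTransGen.trans h h'

lemma Wall.Avoids.sameSide {W : X.Wall} {v : V} {l : List V} (h : W.Avoids (v :: l)) :
    ∀ z ∈ v :: l, W.SameSide v z := by
  induction l generalizing v with
  | nil => intro z hz; rw [List.mem_singleton.1 hz]; exact Relation.ReflTransGen.refl
  | cons w l ih =>
    have h' := List.isChain_cons_cons.1 h
    intro z hz
    rcases List.mem_cons.1 hz with rfl | hz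
    · exact Relation.ReflTransGen.refl
    · exact Relation.ReflTransGen.head h'.1 (ih h'.2 z hz)

lemma Wall.SameSide.exists_avoids {W : X.Wall} {x y : V} (h : W.SameSide x y) :
    ∃ l, W.Avoids (y :: l) ∧ (y :: l).getLast? = some x := by
  induction h with
  | refl => exact ⟨[], by simp [Wall.Avoids], rfl⟩
  | tail _ h ih =>
    obtain ⟨l, h1, h2⟩ := ih
    obtain ⟨e, he, hW⟩ := h
    exact ⟨_, List.isChain_cons_cons.2 ⟨⟨e, by rw [he, Set.pair_comm], hW⟩, h1⟩, by simpa using h2⟩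

lemma Wall.Avoids.isChain {W : X.Wall} {l : List V} (h : W.Avoids l) : l.IsChain X.Adj :=
  List.IsChain.imp (fun _ _ ⟨e, he, _⟩ => e.adj he) h

/-- A reduced path between vertices on the same side of a wall does not cross that wall. -/
theorem Wall.SameSide.avoids (hX : X.IsCAT0) {W : X.Wall} {x y : V} (h : W.SameSide x y)
    {l : List V} (hr : X.Reduced l) (hc : l.IsChain X.Adj) (hy : l.head? = some y)
    (hx : l.getLast? = some x) : W.Avoids l := by
  obtain ⟨q, hq, hqx⟩ := h.exists_avoids
  -- Flips and cancellations never introduce a new wall, so a path avoiding `W` can be reduced to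
  -- one that avoids `W` as well. The given path differs from it by flips.
  obtain ⟨r, hr', h1, h2, h3⟩ := CubeComplex.exists_reduced (X := X)
    (p := fun r => W.Avoids r ∧ r.head? = some y ∧ r.getLast? = some x)
    (fun r r' h ⟨h1, h2, h3⟩ => ⟨h.isChain W.avoids_square h1, h.head?_eq ▸ h2,
      h.getLast?_eq ▸ h3⟩)
    (fun r r' h ⟨h1, h2, h3⟩ => ⟨h.isChain h1, h.head?_eq ▸ h2, h.getLast?_eq ▸ h3⟩)
    _ ⟨hq, rfl, hqx⟩
  have := hr'.flipEq hX hr h1.isChain hc (by rintro rfl; simp at h2) (h2.trans hy.symm)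
    (h3.trans hx.symm)
  exact this.isChain W.avoids_square h1

lemma not_sameSide_of_edge (hX : X.IsCAT0) (e : X.Edge) {x y : V} (he : e.1 = {x, y}) :
    ¬ (X.wall e).SameSide x y := by
  intro h
  have := h.avoids hX (l := [y, x]) (reduced_of_length_lt_three (by simp))
    (by simp [(e.adj he).symm]) rfl rfl
  obtain ⟨f, hf, hne⟩ := (List.isChain_cons_cons.1 this).1
  exact hne (congrArg X.wall (Subtype.ext (by rw [hf, he, Set.pair_comm])))

/-- All rungs are dual to the same wall, and each edge of the rail is adjacent to a rung in a
square. -/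
lemma Ladder.avoids (hX : X.IsCAT0) {x y : V} {l m : List V} (h : X.Ladder (x :: l) (y :: m))
    {e : X.Edge} (he : e.1 = {x, y}) : (X.wall e).Avoids (x :: l) := by
  induction l generalizing x y m e with
  | nil => simp [Wall.Avoids]
  | cons x' l ih =>
    cases h with
    | @cons _ _ y' _ _ m hs h =>
      have hw : X.wall hs.2.1.edge = X.wall e := hs.rotate.wall_eq rfl he
      refine List.isChain_cons_cons.2 ⟨⟨hs.1.edge, rfl, ?_⟩, ?_⟩
      · rw [← hw]
        exact hs.wall_ne hX rfl rfl
      · rw [← hw]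
        exact ih h rfl

/-- Two edges dual to the same wall are joined by a ladder along a reduced path. -/
lemma exists_reduced_ladder (hX : X.IsCAT0) {e f : X.Edge} (hw : X.wall e = X.wall f)
    {x y x' y' : V} (he : e.1 = {x, y}) (hf : f.1 = {x', y'})
    (hs : (X.wall e).SameSide x x') :
    ∃ l m, X.Ladder (x' :: l) (y' :: m) ∧ X.Reduced (x' :: l) ∧
      (x' :: l).getLast? = some x ∧ (y' :: m).getLast? = some y := by
  obtain ⟨x'', y'', l, m, h1, h2, h3, h4⟩ := exists_ladder_of_wall_eq hw he
  have h1' := h1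
  rw [hf, Set.pair_eq_pair_iff] at h1
  rcases h1 with ⟨rfl, rfl⟩ | ⟨rfl, rfl⟩
  · obtain ⟨r, m', hrm, hred, e1, e2, e3, e4⟩ := h2.exists_reduced hX.1
    obtain ⟨_, _, _, _, rfl, rfl, -⟩ := hrm.exists_cons
    simp only [List.head?_cons, Option.some.injEq] at e1 e3
    subst e1 e3
    exact ⟨_, _, hrm, hred, e2.trans h3, e4.trans h4⟩
  -- In the wrong orientation the rail joins `x` to `y'` without crossing the wall. Both ends of `f`
  -- would then be on the same side of the wall dual to `f`.
  · exfalso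
    have hav := (h2.avoids hX h1').sameSide x (List.mem_of_getLast? h3)
    rw [← hw] at hav
    have := not_sameSide_of_edge hX f hf
    rw [← hw] at this
    exact this (hav.trans hs).symm

end Ladders

end CubeComplex

namespace CubeComplex

/-! ### Midpoints, walls and half-spaces in the geometric realisation. -/

section HalfSpaces

variable {V : Type*} {X : CubeComplex V}

lemma Edge.mem_cubes (e : X.Edge) : e.1 ∈ X.cubes := by
  obtain ⟨x, y, h, he⟩ := e.2
  rw [he]
  exact h.2

lemma cubePoint_apply {n : ℕ} {φ : (Fin n → Bool) → V} (hφ : Function.Injective φ) (t : Fin n → ℝ)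
    (b : Fin n → Bool) : cubePoint φ t (φ b) = ∏ i, (if b i then t i else 1 - t i) := by
  unfold cubePoint
  rw [Fintype.sum_eq_single b fun b' hb' => if_neg fun h => hb' (hφ h), if_pos rfl]

lemma mem_range_of_cubePoint_ne_zero {n : ℕ} {φ : (Fin n → Bool) → V} {t : Fin n → ℝ} {v : V}
    (h : cubePoint φ t v ≠ 0) : v ∈ Set.range φ := by
  by_contra hv
  exact h (Finset.sum_eq_zero fun b _ => if_neg fun hb => hv ⟨b, hb⟩)

/-- The vertices of nonzero weight are those of the smallest face containing the point, and this
face extends in direction `i` unless the coordinate `t i` equals that of the vertex. -/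
lemma cubePoint_update_ne_zero {n : ℕ} {φ : (Fin n → Bool) → V} (hφ : Function.Injective φ)
    {t : Fin n → ℝ} {b : Fin n → Bool} (h : cubePoint φ t (φ b) ≠ 0) {i : Fin n}
    (hi : t i ≠ if b i then 1 else 0) : cubePoint φ t (φ (Function.update b i (!b i))) ≠ 0 := by
  rw [cubePoint_apply hφ, Finset.prod_ne_zero_iff] at h ⊢
  intro k _
  by_cases hk : k = i
  · subst hk
    rw [Function.update_self]
    cases hb : b k
    · simpa [hb] using hi
    · simp only [hb, if_true] at hi
      simpa [sub_eq_zero] using hi.symm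
  · rw [Function.update_of_ne hk]
    exact h k (Finset.mem_univ _)

lemma cubePoint_half_ne_zero {n : ℕ} {φ : (Fin n → Bool) → V} (hφ : Function.Injective φ)
    (b : Fin n → Bool) : cubePoint φ (fun _ => 1 / 2) (φ b) ≠ 0 := by
  rw [cubePoint_apply hφ, Finset.prod_ne_zero_iff]
  intro k _
  split_ifs <;> norm_num

variable (X) in
/-- `p` is the centre of the cube with vertex set `C`. -/
def IsCentre (p : X.Point) (C : Set V) : Prop :=
  ∃ (n : ℕ) (φ : (Fin n → Bool) → V), X.HasCoords p.1 φ (fun _ => 1 / 2) ∧ Set.range φ = C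

lemma exists_isCentre {C : Set V} (hC : C ∈ X.cubes) : ∃ p, X.IsCentre p C := by
  obtain ⟨n, φ, hφ, rfl⟩ := X.exists_chart C hC
  have : X.HasCoords (cubePoint φ fun _ => 1 / 2) φ fun _ => 1 / 2 :=
    ⟨hφ, fun _ => ⟨by norm_num, by norm_num⟩, rfl⟩
  exact ⟨⟨_, n, φ, _, this⟩, n, φ, this, rfl⟩

lemma IsCentre.ne_zero_iff {p : X.Point} {C : Set V} (h : X.IsCentre p C) (v : V) :
    p.1 v ≠ 0 ↔ v ∈ C := by
  obtain ⟨n, φ, hp, rfl⟩ := h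
  rw [hp.2.2]
  refine ⟨mem_range_of_cubePoint_ne_zero, ?_⟩
  rintro ⟨b, rfl⟩
  exact cubePoint_half_ne_zero hp.1.1 b

lemma IsCentre.mem_points {p : X.Point} {C : Set V} (h : X.IsCentre p C) {e : X.Edge}
    (he : e.1 ⊆ C) : p ∈ (X.wall e).points := by
  obtain ⟨n, φ, hp, rfl⟩ := h
  obtain ⟨x, y, hxy, hexy⟩ := e.2
  obtain ⟨b, rfl⟩ : x ∈ Set.range φ := he (by rw [hexy]; simp)
  obtain ⟨b', rfl⟩ : y ∈ Set.range φ := he (by rw [hexy]; simp)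
  obtain ⟨i, rfl⟩ := hp.1.exists_update_of_adj hxy
  exact ⟨n, φ, _, i, b, e, hp, rfl, hexy, rfl⟩

/-- In a cube with a midcube in `W`, the edges in the corresponding direction are dual to `W`, and
the vertices of each of the two opposite faces lie on the same side of `W`. -/
lemma IsChart.wall_eq_and_sameSide (hX : X.IsCAT0) {n : ℕ} {φ : (Fin n → Bool) → V}
    (hφ : X.IsChart φ) {b : Fin n → Bool} {i : Fin n} {e : X.Edge}
    (he : e.1 = {φ b, φ (Function.update b i (!b i))}) {β : Fin n → Bool} (hβ : β i = b i) :
    X.wall (hφ.adj_update β i).edge = X.wall e ∧ (X.wall e).SameSide (φ b) (φ β) := by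
  classical
  obtain ⟨Q, hQ⟩ : ∃ Q : (Fin n → Bool) → Prop, ∀ γ, Q γ ↔
      X.wall (hφ.adj_update γ i).edge = X.wall e ∧ (X.wall e).SameSide (φ b) (φ γ) :=
    ⟨_, fun _ => Iff.rfl⟩
  have step : ∀ γ : Fin n → Bool, ∀ k, k ≠ i → Q γ → Q (Function.update γ k (!γ k)) := by
    intro γ k hk h
    rw [hQ] at h ⊢
    obtain ⟨h1, h2⟩ := h
    have hs := hφ.isSquare_update γ hk.symm
    have hw := hs.wall_eq (e := (hφ.adj_update γ i).edge)
      (f := (hφ.adj_update (Function.update γ k (!γ k)) i).edge) rfl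
      (by rw [update_not_comm γ hk.symm]; rfl)
    refine ⟨hw.symm.trans h1, h2.trans (Relation.ReflTransGen.single
      ⟨(hφ.adj_update γ k).edge, rfl, ?_⟩)⟩
    rw [← h1]
    exact hs.rotate.rotate.rotate.wall_ne hX (Set.pair_comm _ _) rfl
  -- The coordinates of `b` are replaced by those of `β` one at a time. Each change is a step across
  -- a square with two edges in direction `i`.
  have key : ∀ S : Finset (Fin n), Q fun k => if k ∈ S then β k else b k := by
    intro S
    induction S using Finset.induction_on with
    | empty =>
      rw [hQ]
      exact ⟨congrArg X.wall (Subtype.ext he.symm), Relation.ReflTransGen.refl⟩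
    | insert k S hk ih =>
      set γ : Fin n → Bool := fun k => if k ∈ S then β k else b k with hγ
      have hγk : γ k = b k := by simp [hγ, hk]
      by_cases hbk : β k = b k
      · have : (fun l => if l ∈ insert k S then β l else b l) = γ := by
          funext l
          by_cases hl : l = k
          · subst hl; simp [hγ, hbk]
          · simp [hγ, hl]
        rw [this]
        exact ih
      · have : (fun l => if l ∈ insert k S then β l else b l) = Function.update γ k (!γ k) := by
          funext l
          by_cases hl : l = k
          · subst hl
            rw [Function.update_self, hγk, if_pos (Finset.mem_insert_self _ _)]
            exact Bool.eq_not_of_ne hbk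
          · rw [Function.update_of_ne hl]
            simp [hγ, hl]
        rw [this]
        exact step γ k (by rintro rfl; exact hbk hβ) ih
  simpa [hQ] using key Finset.univ

/-- The weights of the midpoint vanish off the ends of the edge. A coordinate equal to `1 / 2`
leaves the support invariant under switching it, so it must be the direction of the edge. Midpoints
thus recover walls from their points. -/
lemma IsCentre.wall_eq_of_mem_points (hX : X.IsCAT0) {p : X.Point} {e : X.Edge}
    (h : X.IsCentre p e.1) {W : X.Wall} (hp : p ∈ W.points) : X.wall e = W := by
  obtain ⟨n, φ, t, i, b, f, hc, hti, hf, rfl⟩ := hp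
  obtain ⟨x, y, hxy, he⟩ := e.2
  have hne : ∀ v, cubePoint φ t v ≠ 0 ↔ v ∈ e.1 := fun v => by
    rw [← h.ne_zero_iff, hc.2.2]
  have hx : cubePoint φ t x ≠ 0 := (hne x).2 (by rw [he]; simp)
  obtain ⟨β, rfl⟩ := mem_range_of_cubePoint_ne_zero hx
  have hup : φ (Function.update β i (!β i)) ∈ e.1 := (hne _).1 <|
    cubePoint_update_ne_zero hc.1.1 hx (by rw [hti]; split_ifs <;> norm_num)
  have hy : y = φ (Function.update β i (!β i)) := by
    rw [he] at hup
    rcases hup with h | h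
    · exact absurd h (hc.1.adj_update β i).1.symm
    · exact h.symm
  subst hy
  by_cases hβ : β i = b i
  · rw [← (hc.1.wall_eq_and_sameSide hX hf hβ).1]
    exact congrArg X.wall (Subtype.ext he)
  · have hβ' : Function.update β i (!β i) i = b i := by
      rw [Function.update_self, Bool.eq_not_of_ne hβ, Bool.not_not]
    rw [← (hc.1.wall_eq_and_sameSide hX hf hβ').1]
    refine congrArg X.wall (Subtype.ext ?_)
    rw [he, Set.pair_comm]
    simp [Adj.edge]

lemma exists_hasCoords_vertexPoint (x : V) : ∃ (n : ℕ) (φ : (Fin n → Bool) → V) (t : Fin n → ℝ),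
    X.HasCoords (X.vertexPoint x).1 φ t ∧ ∀ b, φ b = x := by
  classical
  obtain ⟨n, φ, hφ, hr⟩ := X.exists_chart {x} (X.singleton_mem x)
  have hv : ∀ b, φ b = x := fun b => by
    have : φ b ∈ Set.range φ := ⟨b, rfl⟩
    rw [hr] at this
    exact this
  refine ⟨n, φ, fun _ => 0, ⟨hφ, fun _ => by simp, ?_⟩, hv⟩
  have hone : ∀ b : Fin n → Bool, b = fun _ => false := fun b => hφ.1 (by rw [hv, hv])
  funext u
  unfold cubePoint vertexPoint
  rw [Fintype.sum_eq_single (fun _ => false) (fun b hb => absurd (hone b) hb)]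
  simp [hv]

lemma vertexPoint_ne_zero_iff {x v : V} : (X.vertexPoint x).1 v ≠ 0 ↔ v = x := by
  classical
  change (if x = v then (1 : ℝ) else 0) ≠ 0 ↔ _
  by_cases h : x = v
  · simp [h]
  · simp [h, Ne.symm h]

lemma vertexPoint_mem_halfSpace (hX : X.IsCAT0) {W : X.Wall} {z x : V} :
    X.vertexPoint x ∈ W.halfSpace z ↔ W.SameSide z x := by
  constructor
  · rintro ⟨n, φ, t, hc, h⟩
    have hne : ∀ v, cubePoint φ t v ≠ 0 ↔ v = x := fun v => by
      rw [← vertexPoint_ne_zero_iff (X := X), hc.2.2]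
    have hx : cubePoint φ t x ≠ 0 := (hne x).2 rfl
    obtain ⟨β, rfl⟩ := mem_range_of_cubePoint_ne_zero hx
    rcases h with h | ⟨i, b, e, he, rfl, hs, ht⟩
    · exact h β
    -- A vertex has no other vertex in its support, so its coordinates are 0 or 1, and the distance
    -- bound `1 / 2` selects the face of `b`.
    · have hti : t i = if β i then 1 else 0 := by
        by_contra hti
        exact (hc.1.adj_update β i).1 ((hne _).1 (cubePoint_update_ne_zero hc.1.1 hx hti)).symm
      have hβ : β i = b i := by
        rw [hti] at ht
        cases h1 : β i <;> cases h2 : b i <;> simp [h1, h2] at ht ⊢ <;> norm_num at ht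
      exact hs.trans (hc.1.wall_eq_and_sameSide hX he hβ).2
  · intro h
    obtain ⟨n, φ, t, hc, hφ⟩ := exists_hasCoords_vertexPoint (X := X) x
    exact ⟨n, φ, t, hc, .inl fun b => by rwa [hφ]⟩

lemma IsCentre.mem_halfSpace {p : X.Point} {e : X.Edge} (hp : X.IsCentre p e.1) {x y : V}
    (he : e.1 = {x, y}) {W : X.Wall} {z : V} (hx : W.SameSide z x) : p ∈ W.halfSpace z := by
  obtain ⟨n, φ, hc, hr⟩ := hp
  refine ⟨n, φ, _, hc, ?_⟩
  by_cases hw : X.wall e = W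
  · right
    obtain ⟨b, rfl⟩ : x ∈ Set.range φ := by rw [hr, he]; simp
    obtain ⟨b', rfl⟩ : y ∈ Set.range φ := by rw [hr, he]; simp
    obtain ⟨i, rfl⟩ := hc.1.exists_update_of_adj (e.adj he)
    refine ⟨i, b, e, he, hw, hx, ?_⟩
    split_ifs <;> norm_num [abs_le]
  · left
    intro b
    have : φ b ∈ e.1 := hr ▸ ⟨b, rfl⟩
    rw [he] at this
    rcases this with h | h
    · rwa [h]
    · rw [h]
      exact hx.tail ⟨e, he, hw⟩

end HalfSpaces

/-! ### Convexity of `Z` and the edges that leave it. -/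

section Triples

variable {V : Type*} {X : CubeComplex V} {G : Type*} [Group G] [MulAction G V] [X.CubicalAction G]
  {K : Subgroup G} [K.Normal] {R : ℝ} {k : ℕ}

lemma Triple.exists_halfSpaces (hX : X.IsCAT0) (T : X.Triple K R k) :
    ∃ S : Set (X.Wall × V), (∀ p, p ∈ T.Z ↔ ∀ q ∈ S, p ∈ q.1.halfSpace q.2) ∧
      ∀ x, x ∈ vertices T.Z ↔ ∀ q ∈ S, q.1.SameSide q.2 x := by
  obtain ⟨F, hF, hZ⟩ := T.isInter
  have key : ∀ p, p ∈ T.Z ↔ ∀ q ∈ {q : X.Wall × V | q.1.halfSpace q.2 ∈ F},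
      p ∈ q.1.halfSpace q.2 := fun p => by
    rw [hZ]
    refine ⟨fun h q hq => h _ hq, fun h A hA => ?_⟩
    obtain ⟨W, x, rfl⟩ := hF A hA
    exact h (W, x) hA
  refine ⟨_, key, fun x => ?_⟩
  refine (key (X.vertexPoint x)).trans ?_
  simp only [vertexPoint_mem_halfSpace hX]

/-- The vertex set of `Z` is convex. -/
lemma Triple.mem_vertices_of_reduced (hX : X.IsCAT0) (T : X.Triple K R k) {x y : V}
    (hx : x ∈ vertices T.Z) (hy : y ∈ vertices T.Z) {l : List V} (hr : X.Reduced (y :: l))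
    (hc : (y :: l).IsChain X.Adj) (hlast : (y :: l).getLast? = some x) :
    ∀ v ∈ y :: l, v ∈ vertices T.Z := by
  obtain ⟨S, -, hS⟩ := T.exists_halfSpaces hX
  intro v hv
  rw [hS] at hx hy ⊢
  intro q hq
  have h := ((hx q hq).symm.trans (hy q hq)).avoids hX hr hc rfl hlast
  exact (hy q hq).trans (h.sameSide v hv)

lemma Triple.CrossesOut.exists_ends {T : X.Triple K R k} {e : X.Edge} (h : T.CrossesOut e) :
    ∃ x y, e.1 = {x, y} ∧ x ∈ vertices T.Z ∧ y ∉ vertices T.Z := by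
  obtain ⟨⟨x, hx, hxZ⟩, ⟨y, hy, hyZ⟩⟩ := h
  obtain ⟨a, b, hab, he⟩ := e.2
  rw [he] at hx hy ⊢
  have hxy : x ≠ y := by rintro rfl; exact hyZ hxZ
  rcases hx with rfl | rfl <;> rcases hy with rfl | rfl
  · exact absurd rfl hxy
  · exact ⟨x, y, rfl, hxZ, hyZ⟩
  · exact ⟨x, y, Set.pair_comm _ _, hxZ, hyZ⟩
  · exact absurd rfl hxy

lemma Triple.crossesOut_of_ends {T : X.Triple K R k} {e : X.Edge} {x y : V} (he : e.1 = {x, y})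
    (hx : x ∈ vertices T.Z) (hy : y ∉ vertices T.Z) : T.CrossesOut e :=
  ⟨⟨x, by rw [he]; simp, hx⟩, y, by rw [he]; simp, hy⟩

/-- `Z` lies on one side of the wall of an edge that crosses out of `Z`. -/
lemma Triple.CrossesOut.sameSide (hX : X.IsCAT0) {T : X.Triple K R k} {e : X.Edge}
    (h : T.CrossesOut e) {x y : V} (hx : x ∈ vertices T.Z) (hy : y ∈ vertices T.Z) :
    (X.wall e).SameSide x y := by
  obtain ⟨S, -, hS⟩ := T.exists_halfSpaces hX
  obtain ⟨a, b, he, ha, hb⟩ := h.exists_ends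
  rw [hS] at ha hb hx hy
  push Not at hb
  obtain ⟨q, hq, hb⟩ := hb
  -- The half-space `q` excludes one end of `e` but not the other, so its wall is the only one that
  -- `e` crosses.
  have : X.wall e = q.1 := by
    by_contra hne
    exact hb ((ha q hq).tail ⟨e, he, hne⟩)
  rw [this]
  exact (hx q hq).symm.trans (hy q hq)

lemma Triple.CrossesOut.notMem (hX : X.IsCAT0) {T : X.Triple K R k} {e f : X.Edge}
    (h : T.CrossesOut e) (hw : X.wall f = X.wall e) {x y : V} (hf : f.1 = {x, y})
    (hx : x ∈ vertices T.Z) : y ∉ vertices T.Z := fun hy =>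
  not_sameSide_of_edge hX f hf (hw ▸ h.sameSide hX hx hy)

lemma Triple.CrossesOut.centre_mem (hX : X.IsCAT0) {T : X.Triple K R k} {e : X.Edge}
    (h : T.CrossesOut e) {p : X.Point} (hp : X.IsCentre p e.1) : p ∈ T.Z := by
  obtain ⟨S, hS, hS'⟩ := T.exists_halfSpaces hX
  obtain ⟨x, y, he, hx, -⟩ := h.exists_ends
  rw [hS]
  rw [hS'] at hx
  exact fun q hq => hp.mem_halfSpace he (hx q hq)

/-- The edges dual to a portal are joined by squares with an edge in `Z`. -/
lemma Triple.CrossesOut.exists_ladder (hX : X.IsCAT0) {T : X.Triple K R k} {e f : X.Edge}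
    (he : T.CrossesOut e) (hw : X.wall e = X.wall f) {x y x' y' : V} (hxy : e.1 = {x, y})
    (hxy' : f.1 = {x', y'}) (hx : x ∈ vertices T.Z) (hx' : x' ∈ vertices T.Z) :
    ∃ l m, X.Ladder (x' :: l) (y' :: m) ∧ (x' :: l).getLast? = some x ∧
      (y' :: m).getLast? = some y ∧ ∀ v ∈ x' :: l, v ∈ vertices T.Z := by
  obtain ⟨l, m, h1, h2, h3, h4⟩ := exists_reduced_ladder hX hw hxy hxy' (he.sameSide hX hx hx')
  exact ⟨l, m, h1, h3, h4, T.mem_vertices_of_reduced hX hx hx' h2 h1.isChain h3⟩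

end Triples

end CubeComplex

namespace CubeComplex

/-! ### Crossing walls are close in `Γ`. -/

section Distances

variable {V : Type*} {X : CubeComplex V}

lemma StringLength.nonneg {p q : X.Point} {ℓ : ℝ} (h : X.StringLength p q ℓ) : 0 ≤ ℓ := by
  induction h with
  | nil => exact le_rfl
  | cons hs _ ih =>
    obtain ⟨n, φ, s, t, -, -, rfl⟩ := hs
    exact add_nonneg (Real.sqrt_nonneg _) ih

lemma dist_nonneg (p q : X.Point) : 0 ≤ X.dist p q :=
  Real.sInf_nonneg fun _ h => StringLength.nonneg h

lemma dist_self (p : X.Point) : X.dist p p = 0 :=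
  le_antisymm (csInf_le ⟨0, fun _ h => StringLength.nonneg h⟩ (.nil p)) (dist_nonneg p p)

variable {G : Type*} [Group G] [MulAction G V] [X.CubicalAction G] {K : Subgroup G}

/-- Walls that cross in a square have distance at most one in `Γ`. -/
lemma IsSquare.edist_wall_le_one {R : ℝ} (hR : 0 ≤ R) {a b c d : V} (hs : X.IsSquare a b c d)
    {e f : X.Edge} (he : e.1 = {a, b}) (hf : f.1 = {b, c}) :
    (X.wallGraph K R).edist ((X.wall e).bar K) ((X.wall f).bar K) ≤ 1 := by
  rw [SimpleGraph.edist_le_one_iff_adj_or_eq]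
  by_cases heq : (X.wall e).bar K = (X.wall f).bar K
  · exact .inr heq
  · left
    -- The centre of the square lies on both walls, so their distance is at most 0.
    obtain ⟨p, hp⟩ := exists_isCentre hs.2.2.2.2.2.2
    rw [wallGraph, SimpleGraph.fromRel_adj]
    refine ⟨heq, .inl (le_trans (csInf_le ⟨0, ?_⟩ ?_) hR)⟩
    · rintro _ ⟨W₁, W₂, -, -, p, -, q, -, rfl⟩
      exact dist_nonneg p q
    · refine ⟨X.wall e, X.wall f, rfl, rfl, p, hp.mem_points ?_, p, hp.mem_points ?_,
        (dist_self p).symm⟩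
      · rw [he]; intro v; simp; tauto
      · rw [hf]; intro v; simp; tauto

end Distances

/-! ### Colour classes, edge classes and the action of `G` on them. -/

section Classes

variable {V : Type*} {X : CubeComplex V} {G : Type*} [Group G] [MulAction G V] [X.CubicalAction G]
  {K : Subgroup G} {R : ℝ} {k : ℕ}

lemma Colouring.ext {c c' : X.Colouring K R k} (h : ∀ a, c.colour a = c'.colour a) : c = c' :=
  RelHom.ext fun a => Subtype.ext (h a)

lemma Colouring.one_le_colour (c : X.Colouring K R k) (a : X.QuotWall K) : 1 ≤ c.colour a :=
  ((show (X.wallGraph K R).Coloring (Set.Icc 1 (k + 1) : Set ℕ) from c) a).2.1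

lemma mem_colourClass_self (W : X.Wall) (c : X.Colouring K R k) : c ∈ colourClass W c :=
  fun _ _ => rfl

/-- The centre of the ball belongs to the ball, so colourings in one class also agree on its radius.
This makes the relation symmetric and transitive. -/
lemma colourClass_eq_iff {W : X.Wall} {c c' : X.Colouring K R k} :
    colourClass W c = colourClass W c' ↔ c' ∈ colourClass W c := by
  refine ⟨fun h => h ▸ mem_colourClass_self W c', fun h => ?_⟩
  have h0 : c'.colour (W.bar K) = c.colour (W.bar K) := h _ (by simp)
  ext d
  refine forall_congr' fun a => ?_
  rw [h0]
  refine imp_congr_right fun ha => ?_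
  rw [h a ha]

lemma mem_edgeClass {e f : X.Edge} {c d : X.Colouring K R k} :
    (f, d) ∈ edgeClass e c ↔ f = e ∧ d ∈ colourClass (X.wall e) c := Iff.rfl

lemma edgeClass_eq_iff {e f : X.Edge} {c c' : X.Colouring K R k} :
    edgeClass e c = edgeClass f c' ↔ e = f ∧ c' ∈ colourClass (X.wall e) c := by
  constructor
  · intro h
    have h1 : (e, c) ∈ edgeClass f c' := h ▸ mem_edgeClass.2 ⟨rfl, mem_colourClass_self _ _⟩
    have h2 : (f, c') ∈ edgeClass e c := h ▸ mem_edgeClass.2 ⟨rfl, mem_colourClass_self _ _⟩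
    exact ⟨h1.1, h2.2⟩
  · rintro ⟨rfl, h⟩
    unfold edgeClass
    rw [colourClass_eq_iff.2 h]

lemma wall_smul (g : G) (e : X.Edge) : X.wall (g • e) = g • X.wall e := rfl

lemma Edge.smul_coe (g : G) (e : X.Edge) : (g • e).1 = g • e.1 := rfl

lemma Edge.smul_eq_pair (g : G) {e : X.Edge} {x y : V} (h : e.1 = {x, y}) :
    (g • e).1 = {g • x, g • y} := by
  rw [Edge.smul_coe, h, ← Set.image_smul, Set.image_pair]

variable [K.Normal]

lemma Wall.bar_smul (g : G) (W : X.Wall) : (g • W).bar K = g • W.bar K := rfl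

lemma Colouring.colour_smul (g : G) (c : X.Colouring K R k) (a : X.QuotWall K) :
    (g • c).colour a = c.colour (g⁻¹ • a) := rfl

instance : MulAction G (X.Colouring K R k) where
  one_smul c := Colouring.ext fun a => by rw [Colouring.colour_smul, inv_one, one_smul]
  mul_smul g h c := Colouring.ext fun a => by
    simp only [Colouring.colour_smul, mul_inv_rev, mul_smul]

lemma edist_smul (g : G) (a b : X.QuotWall K) :
    (X.wallGraph K R).edist (g • a) (g • b) = (X.wallGraph K R).edist a b := by
  have key : ∀ (g : G) (a b : X.QuotWall K),
      (X.wallGraph K R).edist (g • a) (g • b) ≤ (X.wallGraph K R).edist a b := by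
    intro g a b
    refine le_iInf fun p => ?_
    let φ : X.wallGraph K R →g X.wallGraph K R := ⟨fun a => g • a, fun h => wallGraph_adj_smul g h⟩
    have := SimpleGraph.edist_le (p.map φ)
    rwa [SimpleGraph.Walk.length_map] at this
  refine le_antisymm (key g a b) ?_
  have := key g⁻¹ (g • a) (g • b)
  rwa [inv_smul_smul, inv_smul_smul] at this

lemma smul_colourClass_subset (g : G) (W : X.Wall) (c : X.Colouring K R k) :
    g • colourClass W c ⊆ colourClass (g • W) (g • c) := by
  rintro _ ⟨d, hd, rfl⟩ a ha
  refine hd (g⁻¹ • a) ?_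
  rw [Colouring.colour_smul, Wall.bar_smul, inv_smul_smul] at ha
  rwa [← edist_smul g, smul_inv_smul]

lemma smul_colourClass (g : G) (W : X.Wall) (c : X.Colouring K R k) :
    g • colourClass W c = colourClass (g • W) (g • c) := by
  refine (smul_colourClass_subset g W c).antisymm ?_
  have := smul_colourClass_subset g⁻¹ (g • W) (g • c)
  rw [inv_smul_smul, inv_smul_smul, Set.smul_set_subset_iff_subset_inv_smul_set, inv_inv] at this
  exact this

lemma smul_edgeClass (g : G) (e : X.Edge) (c : X.Colouring K R k) :
    g • edgeClass e c = edgeClass (g • e) (g • c) := by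
  ext ⟨f, d⟩
  rw [Set.mem_smul_set_iff_inv_smul_mem]
  change (g⁻¹ • f, g⁻¹ • d) ∈ edgeClass e c ↔ _
  rw [mem_edgeClass, mem_edgeClass, inv_smul_eq_iff, wall_smul, ← smul_colourClass,
    Set.mem_smul_set_iff_inv_smul_mem]

end Classes

/-! ### Dual edges of a portal and a common colouring for them. -/

section Portals

variable {V : Type*} {X : CubeComplex V} {G : Type*} [Group G] [MulAction G V] [X.CubicalAction G]
  {K : Subgroup G} [K.Normal] {R : ℝ} {k : ℕ} {ι : Type*} {L : X.SideLabelling G} {j : ℕ}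
  {T : ι → X.Triple K R k}

lemma Edge.eq_pair_of_mem {e : X.Edge} {x y : V} (hx : x ∈ e.1) (hy : y ∈ e.1) (hne : x ≠ y) :
    e.1 = {x, y} := by
  obtain ⟨a, b, -, he⟩ := e.2
  rw [he] at hx hy ⊢
  rcases hx with rfl | rfl <;> rcases hy with rfl | rfl
  · exact absurd rfl hne
  · rfl
  · exact Set.pair_comm _ _
  · exact absurd rfl hne

lemma Edge.exists_eq_pair {e : X.Edge} {x : V} (hx : x ∈ e.1) : ∃ y, e.1 = {x, y} := by
  obtain ⟨a, b, -, he⟩ := e.2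
  rw [he] at hx ⊢
  rcases hx with rfl | rfl
  · exact ⟨b, rfl⟩
  · exact ⟨a, Set.pair_comm _ _⟩

lemma IsStage.triple_edgeClass (hT : IsStage L j T) {i : ι} {e : X.Edge} (x : vertices (T i).Z)
    (hx : x.1 ∈ e.1) : (T i).edgeClass e = edgeClass e ((T i).c x) := by
  ext q
  constructor
  · rintro ⟨y, hy, hq⟩
    by_cases hxy : x = y
    · rwa [hxy]
    · rwa [hT.edgeClass_eq i e x y (Edge.eq_pair_of_mem hx hy fun h => hxy (Subtype.ext h))]
  · exact fun hq => ⟨x, hx, hq⟩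

lemma Triple.exists_mem_of_edgeClass_eq {T : X.Triple K R k} {e f : X.Edge} {g : G}
    {c : X.Colouring K R k} (h : g • T.edgeClass e = CubeComplex.edgeClass f c) :
    ∃ x : vertices T.Z, x.1 ∈ e.1 := by
  have : (f, c) ∈ g • T.edgeClass e := h ▸ mem_edgeClass.2 ⟨rfl, mem_colourClass_self _ _⟩
  obtain ⟨q, ⟨x, hx, -⟩, -⟩ := this
  exact ⟨x, hx⟩

/-- Neighbouring vertices of `Z` have colourings that agree on the ball of radius `j` about every
wall adjacent to the wall that separates them. -/
lemma IsStage.colour_eq (hT : IsStage L j T) {i : ι} {a : X.Edge} (x y : vertices (T i).Z)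
    (ha : a.1 = {x.1, y.1}) {W : X.Wall}
    (hW : (X.wallGraph K R).edist ((X.wall a).bar K) (W.bar K) ≤ 1) {v : X.QuotWall K}
    (hv : (X.wallGraph K R).edist (W.bar K) v ≤ j) :
    ((T i).c y).colour v = ((T i).c x).colour v := by
  have h1 := (edgeClass_eq_iff.1 (hT.edgeClass_eq i a x y ha)).2
  have h2 := (hT.mem_iff i a x y.1 ha).1 y.2
  -- Both ends of `a` lie in `Z`, so its colour is at least `j + 1`; this radius absorbs the step
  -- from the wall of `a` to `W`.
  refine h1 v ?_
  calc _ ≤ (X.wallGraph K R).edist ((X.wall a).bar K) (W.bar K) +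
        (X.wallGraph K R).edist (W.bar K) v := SimpleGraph.edist_triangle
    _ ≤ 1 + j := add_le_add hW hv
    _ = ((j + 1 : ℕ) : ℕ∞) := by push_cast; rw [add_comm]
    _ ≤ _ := by exact_mod_cast h2

namespace Portal

lemma exists_dual (P : Portal j T) : ∃ e, P.Dual e := by
  obtain ⟨e, h1, h2, -⟩ := P.isBoundary
  exact ⟨e, h1, h2⟩

lemma dual_of_mem (hX : X.IsCAT0) (P : Portal j T) {e : X.Edge} {x : V} (hx : x ∈ e.1)
    (hxZ : x ∈ vertices P.triple.Z) (hw : X.wall e = P.wall) : P.Dual e := by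
  obtain ⟨y, he⟩ := Edge.exists_eq_pair hx
  obtain ⟨f, hf, hfw⟩ := P.exists_dual
  exact ⟨Triple.crossesOut_of_ends he hxZ (hf.notMem hX (hw.trans hfw.symm) he hxZ), hw⟩

/-- The edges dual to a portal are connected by squares with an edge in `Z`. -/
lemma dual_induction (hX : X.IsCAT0) (P : Portal j T) {p : X.Edge → Prop} {e₀ : X.Edge}
    (h₀ : P.Dual e₀) (hp₀ : p e₀)
    (step : ∀ (e f : X.Edge) (x x' y y' : V), X.IsSquare x' x y y' → e.1 = {x, y} → f.1 = {x', y'} →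
      x ∈ vertices P.triple.Z → x' ∈ vertices P.triple.Z → P.Dual e → P.Dual f → p e → p f)
    {e : X.Edge} (he : P.Dual e) : p e := by
  obtain ⟨x₀, y₀, hxy₀, hx₀, -⟩ := h₀.1.exists_ends
  obtain ⟨x', y', hxy', hx', -⟩ := he.1.exists_ends
  obtain ⟨l, m, h1, h2, h3, h4⟩ :=
    h₀.1.exists_ladder hX (h₀.2.trans he.2.symm) hxy₀ hxy' hx₀ hx'
  clear hx'
  induction l generalizing x' y' m e with
  | nil =>
    cases h1 with
    | single =>
      obtain rfl : x' = x₀ := by simpa using h2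
      obtain rfl : y' = y₀ := by simpa using h3
      rwa [show e = e₀ from Subtype.ext (hxy'.trans hxy₀.symm)]
  | cons x l ih =>
    cases h1 with
    | @cons _ _ y _ _ m hs h1 =>
      have hw : X.wall hs.2.1.edge = P.wall := (hs.rotate.wall_eq rfl hxy').trans he.2
      have hd : P.Dual hs.2.1.edge := P.dual_of_mem hX (x := x) (by simp [Adj.edge])
        (h4 x (by simp)) hw
      exact step _ e x x' y y' hs rfl hxy' (h4 x (by simp)) (h4 x' (by simp)) hd he
        (ih hd x y rfl m h1 (by simpa using h2) (by simpa using h3)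
          fun v hv => h4 v (List.mem_cons_of_mem _ hv))

/-- The colouring `c` represents the classes of all edges dual to `P`. -/
def IsColouring (P : Portal j T) (c : X.Colouring K R k) : Prop :=
  c.colour (P.wall.bar K) = j ∧ ∀ e, P.Dual e → P.triple.edgeClass e = edgeClass e c

/-- The colouring at an end in `Z` of a dual edge of colour `j` works. By `colour_eq`, going to the
next dual edge across a square does not affect the ball of radius `j` about the wall of the portal.
-/
lemma exists_isColouring (hX : X.IsCAT0) (hR : 0 ≤ R) (hT : IsStage L j T) (P : Portal j T) :
    ∃ c, P.IsColouring c := by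
  obtain ⟨e₀, h1, h2, x₀, hx₀, hj⟩ := P.isBoundary
  refine ⟨_, hj, fun e he => P.dual_induction hX (e₀ := e₀)
    (p := fun e => P.triple.edgeClass e = edgeClass e ((T P.idx).c x₀)) ⟨h1, h2⟩
    (hT.triple_edgeClass x₀ hx₀) ?_ he⟩
  intro e f x x' y y' hs hxy hxy' hx hx' hde hdf hp
  have hxe : x ∈ e.1 := by rw [hxy]; simp
  have hxf : x' ∈ f.1 := by rw [hxy']; simp
  change (T P.idx).edgeClass e = _ at hp
  rw [hT.triple_edgeClass ⟨x, hx⟩ hxe, eq_comm, edgeClass_eq_iff] at hp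
  change (T P.idx).edgeClass f = _
  rw [hT.triple_edgeClass ⟨x', hx'⟩ hxf, eq_comm, edgeClass_eq_iff]
  refine ⟨rfl, fun v hv => ?_⟩
  have hp := hp.2 v
  rw [hde.2] at hp
  rw [hdf.2] at hv
  rw [← hp hv]
  rw [hj] at hv
  refine hT.colour_eq (a := hs.1.symm.edge) ⟨x, hx⟩ ⟨x', hx'⟩ rfl (W := P.wall) ?_ hv
  rw [← hde.2]
  exact hs.edist_wall_le_one hR (Set.pair_comm _ _) hxy

lemma IsColouring.mem_colourClass {P : Portal j T} {c : X.Colouring K R k} (hc : P.IsColouring c)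
    (hT : IsStage L j T) {e : X.Edge} (he : P.Dual e) (x : vertices P.triple.Z) (hx : x.1 ∈ e.1) :
    P.triple.c x ∈ colourClass P.wall c := by
  have := hc.2 e he
  change (T P.idx).edgeClass e = _ at this
  rw [hT.triple_edgeClass x hx, eq_comm, edgeClass_eq_iff, he.2] at this
  exact this.2

lemma IsColouring.one_le {P : Portal j T} {c : X.Colouring K R k} (hc : P.IsColouring c) : 1 ≤ j :=
  hc.1 ▸ c.one_le_colour _

/-- The colours at an edge dual to `P` tell which neighbouring edges have an end in `Z`. -/
lemma IsColouring.mem_iff {P : Portal j T} {c : X.Colouring K R k} (hc : P.IsColouring c)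
    (hR : 0 ≤ R) (hT : IsStage L j T) {e a : X.Edge} (he : P.Dual e) {x x' y y' : V}
    (hs : X.IsSquare x' x y y') (hxy : e.1 = {x, y}) (ha : a.1 = {x, x'})
    (hx : x ∈ vertices P.triple.Z) :
    x' ∈ vertices P.triple.Z ↔ j < c.colour ((X.wall a).bar K) := by
  rw [← hc.mem_colourClass hT he ⟨x, hx⟩ (by rw [hxy]; simp) ((X.wall a).bar K)]
  · exact hT.mem_iff P.idx a ⟨x, hx⟩ x' ha
  · rw [hc.1, ← he.2, SimpleGraph.edist_comm]
    exact (hs.edist_wall_le_one hR (by rw [ha, Set.pair_comm]) hxy).trans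
      (by exact_mod_cast hc.one_le)

/-- It is not assumed which end of `e` lies in `Z`. If it is `y`, the argument applies to the
opposite side of the square, which is dual to the same wall as `a` and so has the same colour. -/
lemma IsColouring.dual_of_lt {P : Portal j T} {c : X.Colouring K R k} (hc : P.IsColouring c)
    (hX : X.IsCAT0) (hR : 0 ≤ R) (hT : IsStage L j T) {e f a : X.Edge} (he : P.Dual e)
    {x x' y y' : V} (hs : X.IsSquare x' x y y') (hxy : e.1 = {x, y}) (hxy' : f.1 = {x', y'})
    (ha : a.1 = {x, x'}) (hj : j < c.colour ((X.wall a).bar K)) : P.Dual f := by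
  have hw : X.wall f = P.wall := (hs.rotate.wall_eq hxy hxy').symm.trans he.2
  obtain ⟨u, hu, huZ⟩ := he.1.1
  rw [hxy] at hu
  rcases hu with rfl | rfl
  · exact P.dual_of_mem hX (x := x') (by rw [hxy']; simp)
      ((hc.mem_iff hR hT he hs hxy ha huZ).2 hj) hw
  · have hs' : X.IsSquare y' u x x' := hs.reflect.rotate
    refine P.dual_of_mem hX (x := y') (by rw [hxy']; simp)
      ((hc.mem_iff hR hT he hs' (by rw [hxy, Set.pair_comm]) (a := hs'.1.symm.edge) rfl huZ).2 ?_) hw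
    rwa [← hs.flip.wall_eq ha (f := hs'.1.symm.edge) rfl]

end Portal

end Portals

end CubeComplex

namespace CubeComplex

/-! ### Local finiteness and finiteness of the gluing sets. -/

section Finiteness

variable {V : Type*} {X : CubeComplex V} {G : Type*} [Group G] [MulAction G V] [X.CubicalAction G]

lemma vertexPoint_smul (g : G) (x : V) : X.vertexPoint (g • x) = g • X.vertexPoint x := by
  classical
  refine Subtype.ext (funext fun v => ?_)
  change (if g • x = v then (1 : ℝ) else 0) = if x = g⁻¹ • v then (1 : ℝ) else 0
  simp only [eq_inv_smul_iff]

lemma smul_points (g : G) (W : X.Wall) : g • W.points = (g • W).points := by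
  ext p
  rw [Set.mem_smul_set_iff_inv_smul_mem]
  constructor
  · intro h
    have := points_smul g h
    rwa [smul_inv_smul] at this
  · intro h
    have := points_smul g⁻¹ h
    rwa [inv_smul_smul] at this

lemma mem_of_mem_closedCube {p : X.Point} {C : Set V} (h : p ∈ X.closedCube C) {v : V}
    (hv : p.1 v ≠ 0) : v ∈ C := by
  obtain ⟨n, φ, t, hc, rfl⟩ := h
  rw [hc.2.2] at hv
  exact mem_range_of_cubePoint_ne_zero hv

/-- A nonempty transporter is a coset of the stabiliser of `v`, which is finite because its elements
keep `v` inside every ball about it. -/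
lemma IsProperAction.finite_transporter (h : X.IsProperAction G) (v w : V) :
    {g : G | g • v = w}.Finite := by
  have hstab : {g : G | g • v = v}.Finite := by
    obtain ⟨r, hr, hfin⟩ := h (X.vertexPoint v)
    refine hfin.subset fun g hg => ⟨X.vertexPoint v, ?_, ?_⟩
    · rwa [dist_self]
    · rw [← vertexPoint_smul, show g • v = v from hg, dist_self]
      exact hr
  by_cases hne : ∃ g₁ : G, g₁ • v = w
  · obtain ⟨g₁, hg₁⟩ := hne
    refine (hstab.image fun g => g₁ * g).subset fun g hg => ⟨g₁⁻¹ * g, ?_, by simp⟩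
    change (g₁⁻¹ * g) • v = v
    rw [mul_smul, show g • v = w from hg, ← hg₁, inv_smul_smul]
  · convert Set.finite_empty
    rw [Set.eq_empty_iff_forall_notMem]
    exact fun g hg => hne ⟨g, hg⟩

/-- A cube complex with a proper cocompact group action is locally finite. -/
lemma finite_edges_at (hproper : X.IsProperAction G)
    (hcocompact : IsCocompactOn (⊤ : Subgroup G) (Set.univ : Set X.Point)) (v : V) :
    {e : X.Edge | v ∈ e.1}.Finite := by
  obtain ⟨F, hF, hFc, hcov⟩ := hcocompact
  have hE : {e : X.Edge | ∃ C ∈ F, e.1 ⊆ C}.Finite := by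
    have : (⋃ C ∈ F, {s : Set V | s ⊆ C}).Finite :=
      hF.biUnion fun C hC => (cube_finite (hFc hC)).finite_subsets
    refine (this.preimage (f := fun e : X.Edge => e.1) Subtype.val_injective.injOn).subset ?_
    rintro e ⟨C, hC, he⟩
    exact Set.mem_biUnion hC he
  -- Some `g` moves a given edge at `v` into one of the finitely many cubes and `v` to an end `w` of
  -- the moved edge. This leaves finitely many moved edges, vertices `w` and elements `g`.
  have hmain : (⋃ e ∈ {e : X.Edge | ∃ C ∈ F, e.1 ⊆ C}, ⋃ w ∈ e.1,
      (fun g : G => g⁻¹ • e) '' {g : G | g • v = w}).Finite :=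
    hE.biUnion fun e _ => (cube_finite e.mem_cubes).biUnion fun w _ =>
      (hproper.finite_transporter v w).image _
  refine hmain.subset fun e he => ?_
  obtain ⟨p, hp⟩ := exists_isCentre e.mem_cubes
  obtain ⟨g, -, C, hC, hgp⟩ := hcov p (Set.mem_univ _)
  refine Set.mem_biUnion (x := g • e) ⟨C, hC, ?_⟩ (Set.mem_biUnion (x := g • v) ?_
    ⟨g, rfl, inv_smul_smul g e⟩)
  · rintro _ ⟨x, hx, rfl⟩
    refine mem_of_mem_closedCube hgp ?_
    change p.1 (g⁻¹ • g • x) ≠ 0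
    rw [inv_smul_smul]
    exact (hp.ne_zero_iff x).2 hx
  · exact Set.smul_mem_smul_set he

variable {K : Subgroup G} [K.Normal] {R : ℝ} {k : ℕ}

lemma Triple.smul_mem_vertices (T : X.Triple K R k) {h : G} (hh : h ∈ T.H) {x : V}
    (hx : x ∈ vertices T.Z) : h • x ∈ vertices T.Z := by
  change X.vertexPoint (h • x) ∈ T.Z
  rw [vertexPoint_smul, ← T.smul_Z h hh]
  exact Set.smul_mem_smul_set hx

lemma Triple.smul_edgeClass_subset (T : X.Triple K R k) {h : G} (hh : h ∈ T.H) (e : X.Edge) :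
    h • T.edgeClass e ⊆ T.edgeClass (h • e) := by
  rintro _ ⟨q, ⟨x, hx, hq⟩, rfl⟩
  refine ⟨⟨h • x.1, T.smul_mem_vertices hh x.2⟩, Set.smul_mem_smul_set hx, ?_⟩
  rw [T.equivariant h hh x ⟨h • x.1, T.smul_mem_vertices hh x.2⟩ rfl, ← CubeComplex.smul_edgeClass]
  exact Set.smul_mem_smul_set hq

lemma Triple.smul_edgeClass (T : X.Triple K R k) {h : G} (hh : h ∈ T.H) (e : X.Edge) :
    h • T.edgeClass e = T.edgeClass (h • e) := by
  refine (T.smul_edgeClass_subset hh e).antisymm ?_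
  have := T.smul_edgeClass_subset (inv_mem hh) (h • e)
  rwa [inv_smul_smul, Set.smul_set_subset_iff_subset_inv_smul_set, inv_inv] at this

/-- Some element of `H` moves an end in `Z` of the edge to one of finitely many vertices, and each
of these lies on finitely many edges. -/
lemma Triple.finite_orbits (hproper : X.IsProperAction G)
    (hcocompact : IsCocompactOn (⊤ : Subgroup G) (Set.univ : Set X.Point)) (T : X.Triple K R k) :
    {O : Set X.Edge | ∃ e : X.Edge, (∃ x : vertices T.Z, x.1 ∈ e.1) ∧
      O = MulAction.orbit T.H e}.Finite := by
  obtain ⟨F, hF, hFc, hcov⟩ := T.cocompact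
  have hV : (⋃ C ∈ F, C).Finite := hF.biUnion fun C hC => cube_finite (hFc hC)
  have hE : (⋃ v ∈ ⋃ C ∈ F, C, {e : X.Edge | v ∈ e.1}).Finite :=
    hV.biUnion fun v _ => finite_edges_at hproper hcocompact v
  refine (hE.image fun e => MulAction.orbit T.H e).subset ?_
  rintro _ ⟨e, ⟨x, hx⟩, rfl⟩
  obtain ⟨h, hh, C, hC, hp⟩ := hcov (X.vertexPoint x.1) x.2
  refine ⟨h • e, Set.mem_biUnion (x := h • x.1) (Set.mem_biUnion hC ?_)
    (Set.smul_mem_smul_set hx), ?_⟩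
  · rw [← vertexPoint_smul] at hp
    exact mem_of_mem_closedCube hp (vertexPoint_ne_zero_iff.2 rfl)
  · exact MulAction.orbit_eq_iff.2 ⟨⟨h, hh⟩, rfl⟩

variable {ι : Type*}

lemma finite_gluingSet (hproper : X.IsProperAction G)
    (hcocompact : IsCocompactOn (⊤ : Subgroup G) (Set.univ : Set X.Point)) [Finite ι]
    (L : X.SideLabelling G) (T : ι → X.Triple K R k) (s : Bool) (f : X.Edge)
    (c : X.Colouring K R k) : (gluingSet L T s f c).Finite := by
  have : (⋃ i : ι, Prod.mk i '' {O : Set X.Edge | ∃ e : X.Edge, (∃ x : vertices (T i).Z, x.1 ∈ e.1) ∧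
      O = MulAction.orbit (T i).H e}).Finite :=
    Set.finite_iUnion fun i => ((T i).finite_orbits hproper hcocompact).image _
  refine this.subset ?_
  rintro _ ⟨i, e, rfl, g, -, hg⟩
  exact Set.mem_iUnion.2 ⟨i, _, ⟨e, Triple.exists_mem_of_edgeClass_eq hg, rfl⟩, rfl⟩

end Finiteness

/-! ### Teleports, stabilisers and portal quotients. -/

section Teleports

variable {V : Type*} {X : CubeComplex V} {G : Type*} [Group G] [MulAction G V] [X.CubicalAction G]
  {K : Subgroup G} [K.Normal] {R : ℝ} {k : ℕ} {ι : Type*} {L : X.SideLabelling G} {j : ℕ}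
  {T : ι → X.Triple K R k}

namespace Portal

/-- Duality spreads across squares: `c` and `g • c'` give the same colour to the wall crossed when
passing to the next edge, and this colour exceeds `j` as that edge is dual to `P`. -/
lemma IsColouring.dual_inv_smul {P P' : Portal j T} {c c' : X.Colouring K R k}
    (hc : P.IsColouring c) (hc' : P'.IsColouring c') (hX : X.IsCAT0) (hR : 0 ≤ R)
    (hT : IsStage L j T) {g : G} {e₀ : X.Edge} (h₀ : P.Dual e₀) (h₀' : P'.Dual (g⁻¹ • e₀))
    (hg : g • c' ∈ colourClass P.wall c) {e : X.Edge} (he : P.Dual e) : P'.Dual (g⁻¹ • e) := by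
  refine P.dual_induction hX (p := fun e => P'.Dual (g⁻¹ • e)) h₀ h₀' ?_ he
  intro e f x x' y y' hs hxy hxy' hx hx' hde hdf hp
  have hj := (hc.mem_iff hR hT hde hs hxy (a := hs.1.symm.edge) rfl hx).1 hx'
  refine hc'.dual_of_lt hX hR hT hp (isSquare_smul g⁻¹ hs) (Edge.smul_eq_pair _ hxy)
    (Edge.smul_eq_pair _ hxy') (a := g⁻¹ • hs.1.symm.edge) (Edge.smul_eq_pair _ rfl) ?_
  rw [← hg] at hj
  · exact hj
  · rw [hc.1, ← hde.2, SimpleGraph.edist_comm]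
    exact (hs.edist_wall_le_one hR (Set.pair_comm _ _) hxy).trans (by exact_mod_cast hc.one_le)

/-- A coincidence of the classes of one pair of dual edges makes the portals teleports of each
other. -/
lemma isTeleport_of_edgeClass_eq (hX : X.IsCAT0) (hR : 0 ≤ R) (hT : IsStage L j T)
    {P P' : Portal j T} {e e' : X.Edge} (he : P.Dual e) (he' : P'.Dual e') {g : G}
    (h : P.triple.edgeClass e = g • P'.triple.edgeClass e') : IsTeleport g P P' := by
  obtain ⟨c, hc⟩ := P.exists_isColouring hX hR hT
  obtain ⟨c', hc'⟩ := P'.exists_isColouring hX hR hT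
  rw [hc.2 e he, hc'.2 e' he', smul_edgeClass, edgeClass_eq_iff] at h
  obtain ⟨rfl, h⟩ := h
  have hW : P.wall = g • P'.wall := by rw [← he.2, ← he'.2, wall_smul]
  rw [he.2] at h
  have h' : g⁻¹ • c ∈ colourClass P'.wall c' := by
    rw [← Set.mem_smul_set_iff_inv_smul_mem, smul_colourClass, ← hW, ← colourClass_eq_iff.2 h]
    exact mem_colourClass_self _ _
  have h1 : ∀ f, P.Dual f → P'.Dual (g⁻¹ • f) := fun f hf =>
    hc.dual_inv_smul hc' hX hR hT he (by rwa [inv_smul_smul]) h hf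
  have h2 : ∀ f, P'.Dual f → P.Dual (g • f) := fun f hf => by
    have := hc'.dual_inv_smul hc hX hR hT (g := g⁻¹) he' (by rwa [inv_inv]) h' hf
    rwa [inv_inv] at this
  have h3 : ∀ f, P.Dual f → P.triple.edgeClass f = g • P'.triple.edgeClass (g⁻¹ • f) := by
    intro f hf
    rw [hc.2 f hf, hc'.2 _ (h1 f hf), smul_edgeClass, smul_inv_smul, edgeClass_eq_iff, hf.2]
    exact ⟨rfl, h⟩
  ext S
  constructor
  · rintro ⟨f, hf, rfl⟩
    exact ⟨_, ⟨g⁻¹ • f, h1 f hf, rfl⟩, (h3 f hf).symm⟩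
  · rintro ⟨_, ⟨f, hf, rfl⟩, rfl⟩
    refine ⟨g • f, h2 f hf, ?_⟩
    change P.triple.edgeClass (g • f) = g • P'.triple.edgeClass f
    rw [h3 _ (h2 f hf), inv_smul_smul]

lemma IsTeleport.symm {P P' : Portal j T} {g : G} (h : IsTeleport g P P') : IsTeleport g⁻¹ P' P := by
  unfold IsTeleport at h ⊢
  rw [h, inv_smul_smul]

lemma IsTeleport.trans {P P' P'' : Portal j T} {g g' : G} (h : IsTeleport g P P')
    (h' : IsTeleport g' P' P'') : IsTeleport (g * g') P P'' := by
  unfold IsTeleport at h h' ⊢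
  rw [h, h', mul_smul]

lemma IsTeleport.dual (hX : X.IsCAT0) (hR : 0 ≤ R) (hT : IsStage L j T) {P P' : Portal j T} {g : G}
    (h : IsTeleport g P P') {e : X.Edge} (he : P.Dual e) :
    P'.Dual (g⁻¹ • e) ∧ P.triple.edgeClass e = g • P'.triple.edgeClass (g⁻¹ • e) := by
  have : P.triple.edgeClass e ∈ g • (P'.triple.edgeClass '' {f | P'.Dual f}) :=
    h ▸ ⟨e, he, rfl⟩
  obtain ⟨_, ⟨f, hf, rfl⟩, hef⟩ := this
  change g • P'.triple.edgeClass f = P.triple.edgeClass e at hef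
  obtain ⟨c, hc⟩ := P.exists_isColouring hX hR hT
  obtain ⟨c', hc'⟩ := P'.exists_isColouring hX hR hT
  have h' := hef
  rw [hc.2 e he, hc'.2 f hf, smul_edgeClass, edgeClass_eq_iff] at h'
  obtain rfl := h'.1
  rw [inv_smul_smul]
  exact ⟨hf, hef.symm⟩

lemma smul_carrier (P : Portal j T) {h : G} (hh : h ∈ P.triple.H) :
    h • P.carrier = P.triple.Z ∩ (h • P.wall).points := by
  unfold carrier
  rw [Set.smul_set_inter, P.triple.smul_Z h hh, smul_points]

lemma wall_eq_of_smul_mem (hX : X.IsCAT0) (P : Portal j T) {e : X.Edge} (he : P.Dual e)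
    {p : X.Point} (hp : X.IsCentre p e.1) {g : G} {W : X.Wall} (hg : g • p ∈ W.points) :
    g • P.wall = W := by
  rw [← he.2, hp.wall_eq_of_mem_points hX (W := g⁻¹ • W), smul_inv_smul]
  rwa [← smul_points, Set.mem_smul_set_iff_inv_smul_mem, inv_inv]

lemma centre_mem_carrier (hX : X.IsCAT0) (P : Portal j T) {e : X.Edge} (he : P.Dual e)
    {p : X.Point} (hp : X.IsCentre p e.1) : p ∈ P.carrier :=
  ⟨he.1.centre_mem hX hp, he.2 ▸ hp.mem_points subset_rfl⟩

/-- The carrier contains the midpoint of a dual edge, and the image of this midpoint lies in no wall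
other than the image of `P.wall`. -/
lemma mem_stab_iff (hX : X.IsCAT0) (P : Portal j T) {h : G} :
    h ∈ P.stab ↔ h ∈ P.triple.H ∧ h • P.wall = P.wall := by
  rw [stab, Subgroup.mem_inf, MulAction.mem_stabilizer_iff]
  refine and_congr_right fun hh => ?_
  constructor
  · intro hP
    obtain ⟨e, he⟩ := P.exists_dual
    obtain ⟨p, hp⟩ := exists_isCentre e.mem_cubes
    refine P.wall_eq_of_smul_mem hX he hp (g := h) ?_
    have : h • p ∈ h • P.carrier := Set.smul_mem_smul_set (P.centre_mem_carrier hX he hp)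
    rw [hP] at this
    exact this.2
  · intro hw
    rw [P.smul_carrier hh, hw]
    rfl

/-- Portals with the same quotient are translates of each other. -/
lemma exists_smul_wall_eq (hX : X.IsCAT0) {P P' : Portal j T} (h : P.quotient = P'.quotient) :
    P.idx = P'.idx ∧ ∃ g ∈ P'.triple.H, g • P.wall = P'.wall := by
  have hi : P.idx = P'.idx := congrArg Prod.fst h
  refine ⟨hi, ?_⟩
  obtain ⟨e, he⟩ := P.exists_dual
  obtain ⟨p, hp⟩ := exists_isCentre e.mem_cubes
  have hmem : MulAction.orbit P.triple.H p ∈ P'.quotient.2 :=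
    h ▸ ⟨p, P.centre_mem_carrier hX he hp, rfl⟩
  obtain ⟨p', hp', horb⟩ := hmem
  have hH : P'.triple.H = P.triple.H := by unfold triple; rw [hi]
  have : p' ∈ MulAction.orbit P.triple.H p := horb ▸ MulAction.mem_orbit_self p'
  obtain ⟨g, rfl⟩ := this
  exact ⟨g, by rw [hH]; exact g.2, P.wall_eq_of_smul_mem hX he hp hp'.2⟩

/-- The portal quotient that belongs to an orbit of edges dual to a portal. -/
def quotientOfOrbit (T : ι → X.Triple K R k) (q : ι × Set X.Edge) : ι × Set (Set X.Point) :=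
  (q.1, MulAction.orbit (T q.1).H '' {p | p ∈ (T q.1).Z ∧ ∃ e ∈ q.2, p ∈ (X.wall e).points})

lemma quotientOfOrbit_eq (P : Portal j T) {e : X.Edge} (he : P.Dual e) :
    quotientOfOrbit T (P.idx, MulAction.orbit P.triple.H e) = P.quotient := by
  refine Prod.ext rfl ?_
  ext O
  constructor
  · rintro ⟨p, ⟨hpZ, _, ⟨h, rfl⟩, hp⟩, rfl⟩
    refine ⟨h⁻¹ • p, ?_, MulAction.orbit_eq_iff.2 ⟨h⁻¹, rfl⟩⟩
    change p ∈ (X.wall ((h : G) • e)).points at hp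
    rw [wall_smul, he.2] at hp
    have : p ∈ (h : G) • P.carrier := by
      rw [P.smul_carrier h.2]
      exact ⟨hpZ, hp⟩
    exact Set.mem_smul_set_iff_inv_smul_mem.1 this
  · rintro ⟨p, hp, rfl⟩
    exact ⟨p, ⟨hp.1, e, MulAction.mem_orbit_self e, he.2 ▸ hp.2⟩, rfl⟩

end Portal

end Teleports

end CubeComplex

lemma Set.ncard_eq_ncard_image_mul {α β : Type*} {A : Set α} (hA : A.Finite) (F : α → β) {m : ℕ}
    (h : ∀ b ∈ F '' A, (A ∩ F ⁻¹' {b}).ncard = m) : A.ncard = (F '' A).ncard * m := by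
  classical
  rw [Set.ncard_eq_toFinset_card A hA, Set.ncard_eq_toFinset_card _ (hA.image F),
    Finset.card_eq_sum_card_fiberwise (f := F) (t := (hA.image F).toFinset)
      (fun a ha => by simpa using ⟨a, by simpa using ha, rfl⟩), ← smul_eq_mul]
  refine Finset.sum_const_nat (fun b hb => ?_)
  rw [← h b (by simpa using hb), ← Set.ncard_coe_finset]
  congr 1
  ext a
  simp

namespace CubeComplex

/-! ### Counting gluing sets over portal quotients. -/

section Counting

variable {V : Type*} {X : CubeComplex V} {G : Type*} [Group G] [MulAction G V] [X.CubicalAction G]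
  {K : Subgroup G} [K.Normal] {R : ℝ} {k : ℕ} {ι : Type*} {L : X.SideLabelling G} {j : ℕ}
  {T : ι → X.Triple K R k}

namespace Portal

/-- An edge whose class is a translate of the class of an edge dual to `P` is dual to a portal that
teleports to `P`. -/
lemma exists_portal (hX : X.IsCAT0) (hR : 0 ≤ R) (hT : IsStage L j T) {P : Portal j T}
    {c : X.Colouring K R k} (hc : P.IsColouring c) {e₀ : X.Edge} (h₀ : P.Dual e₀) {i : ι}
    {e : X.Edge} {g : G} (hg : g • (T i).edgeClass e = edgeClass e₀ c) :
    g • e = e₀ ∧ ∃ P' : Portal j T, P'.idx = i ∧ P'.Dual e ∧ IsTeleport g P P' := by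
  obtain ⟨x, hx⟩ := Triple.exists_mem_of_edgeClass_eq hg
  have hg' := hg
  rw [hT.triple_edgeClass x hx, smul_edgeClass, edgeClass_eq_iff] at hg'
  obtain ⟨rfl, hcol⟩ := hg'
  have hj : ((T i).c x).colour ((X.wall e).bar K) = j := by
    have h := hcol ((X.wall (g • e)).bar K) (by simp)
    rw [Colouring.colour_smul, wall_smul, Wall.bar_smul, inv_smul_smul, ← Wall.bar_smul,
      ← wall_smul, h₀.2, hc.1] at h
    exact h.symm
  obtain ⟨y, hxy⟩ := Edge.exists_eq_pair hx
  -- The teleported colour of `e` is exactly `j`, whereas an edge with both ends in `Z` has a larger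
  -- colour.
  have hout : (T i).CrossesOut e := Triple.crossesOut_of_ends hxy x.2 fun hy =>
    ((hT.mem_iff i e x y hxy).1 hy).ne' hj
  let P' : Portal j T := ⟨i, X.wall e, e, hout, rfl, x, hx, hj⟩
  have hd : P'.Dual e := ⟨hout, rfl⟩
  exact ⟨rfl, P', rfl, hd, isTeleport_of_edgeClass_eq hX hR hT h₀ hd ((hc.2 _ h₀).trans hg.symm)⟩

/-- The `H_P`-orbits of the translates of `e` under the self-teleports of `P`. -/
def selfTeleportOrbits (P : Portal j T) (e : X.Edge) : Set (Set X.Edge) :=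
  {O | ∃ t : G, IsTeleport t P P ∧ O = MulAction.orbit P.stab (t • e)}

/-- The orbits of edges that lead to the triple of `P'` and contain the `g⁻¹`-translates of the edges
in `O`. -/
def translateOrbit (P' : Portal j T) (g : G) (O : Set X.Edge) : ι × Set X.Edge :=
  (P'.idx, {f | ∃ h ∈ P'.triple.H, ∃ e ∈ O, f = h • g⁻¹ • e})

/-- An element of `H_P` becomes an element of `H'_{P'}` after conjugation by `g⁻¹`, so the
translates of one `H_P`-orbit fill a single `H'`-orbit. -/
lemma translateOrbit_orbit {P P' : Portal j T} {g : G}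
    (hstab : P.stab = P'.stab.map (MulAut.conj g).toMonoidHom) (e : X.Edge) :
    translateOrbit P' g (MulAction.orbit P.stab e) =
      (P'.idx, MulAction.orbit P'.triple.H (g⁻¹ • e)) := by
  refine Prod.ext rfl ?_
  ext f
  constructor
  · rintro ⟨h, hh, _, ⟨s, rfl⟩, rfl⟩
    obtain ⟨s', hs', hss⟩ : (s : G) ∈ P'.stab.map (MulAut.conj g).toMonoidHom := hstab.le s.2
    refine ⟨⟨h * s', mul_mem hh hs'.1⟩, ?_⟩
    change (h * s') • g⁻¹ • e = h • g⁻¹ • (s : G) • e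
    rw [← hss]
    simp [mul_smul]
  · rintro ⟨h, rfl⟩
    exact ⟨h, h.2, e, MulAction.mem_orbit_self e, rfl⟩

variable (L) in
lemma isTeleport_wall (hX : X.IsCAT0) (hR : 0 ≤ R) (hT : IsStage L j T) {P P' : Portal j T} {g : G}
    (h : IsTeleport g P P') : P.wall = g • P'.wall := by
  obtain ⟨e, he⟩ := P.exists_dual
  rw [← he.2, ← (h.dual hX hR hT he).1.2, wall_smul, smul_inv_smul]

/-- An element of `H'` carrying one of the translated edges to another carries an edge dual to `P'`
to an edge dual to `P'`. It therefore fixes the wall of `P'`, lies in `H'_{P'}`, and is conjugate by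
`g` to an element of `H_P`. -/
lemma injOn_translateOrbit (hX : X.IsCAT0) (hR : 0 ≤ R) (hT : IsStage L j T) {P P' : Portal j T}
    {g : G} (hg : IsTeleport g P P') (hstab : P.stab = P'.stab.map (MulAut.conj g).toMonoidHom)
    {e₀ : X.Edge} (h₀ : P.Dual e₀) :
    Set.InjOn (translateOrbit P' g) (P.selfTeleportOrbits e₀) := by
  rintro _ ⟨t₁, h₁, rfl⟩ _ ⟨t₂, h₂, rfl⟩ heq
  rw [translateOrbit_orbit hstab, translateOrbit_orbit hstab] at heq
  have key : ∀ t, IsTeleport t P P → P'.Dual (g⁻¹ • t • e₀) := fun t ht => by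
    have := (ht.symm.dual hX hR hT h₀).1
    rw [inv_inv] at this
    exact (hg.dual hX hR hT this).1
  have heq := (Prod.ext_iff.1 heq).2
  obtain ⟨h, hh⟩ := MulAction.orbit_eq_iff.1 heq
  change (h : G) • g⁻¹ • t₂ • e₀ = g⁻¹ • t₁ • e₀ at hh
  have hmem : (h : G) ∈ P'.stab := by
    rw [P'.mem_stab_iff hX]
    refine ⟨h.2, ?_⟩
    conv_lhs => rw [← (key t₂ h₂).2]
    rw [← wall_smul, hh, (key t₁ h₁).2]
  refine MulAction.orbit_eq_iff.2 ⟨⟨g * h * g⁻¹, ?_⟩, ?_⟩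
  · rw [hstab]
    exact ⟨h, hmem, rfl⟩
  · change (g * h * g⁻¹) • t₂ • e₀ = t₁ • e₀
    rw [mul_smul, mul_smul, hh, smul_inv_smul]

/-- Two teleports from `P'` to `P` differ by a self-teleport of `P`, so a single `g₀` accounts for
the whole fibre. That `g₀` gives the right sign is enough, since the labelling of sides is
equivariant and self-teleports fix the wall of `P`. -/
lemma gluingSet_fibre_eq (hX : X.IsCAT0) (hR : 0 ≤ R) (hT : IsStage L j T) {P P' : Portal j T}
    {c : X.Colouring K R k} (hc : P.IsColouring c) {e₀ : X.Edge} (h₀ : P.Dual e₀) {s : Bool} {g₀ : G}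
    (hg₀ : IsTeleport g₀ P P') (hstab : P.stab = P'.stab.map (MulAut.conj g₀).toMonoidHom)
    (hside : (g₀ • vertices P'.triple.Z ∩ L.side P.wall s).Nonempty) :
    gluingSet L T s e₀ c ∩ quotientOfOrbit T ⁻¹' {P'.quotient} =
      translateOrbit P' g₀ '' P.selfTeleportOrbits e₀ := by
  ext q
  constructor
  · rintro ⟨⟨i, e, rfl, g, -, hg⟩, hq⟩
    obtain ⟨rfl, P'', rfl, hd, -⟩ := exists_portal hX hR hT hc h₀ hg
    rw [Set.mem_preimage, Set.mem_singleton_iff] at hq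
    change quotientOfOrbit T (P''.idx, MulAction.orbit P''.triple.H e) = _ at hq
    rw [P''.quotientOfOrbit_eq hd] at hq
    obtain ⟨hi, h, hh, hw⟩ := exists_smul_wall_eq hX hq
    have htr : P''.triple = P'.triple := by unfold triple; rw [hi]
    have hdual : P'.Dual (h • e) := by
      obtain ⟨x, hx, hxZ⟩ := hd.1.1
      rw [htr] at hxZ
      exact P'.dual_of_mem hX (Set.smul_mem_smul_set hx) (P'.triple.smul_mem_vertices hh hxZ)
        (by rw [wall_smul, hd.2, hw])
    have htel : IsTeleport (g * h⁻¹) P P' := by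
      refine isTeleport_of_edgeClass_eq hX hR hT h₀ hdual ?_
      rw [hc.2 _ h₀, ← hg, ← P'.triple.smul_edgeClass hh, mul_smul, inv_smul_smul, ← htr]
      rfl
    -- This self-teleport `t` is chosen such that `g₀⁻¹ • t • e₀ = h • e`, where `e₀ = g • e`.
    refine ⟨_, ⟨g₀ * (g * h⁻¹)⁻¹, hg₀.trans htel.symm, rfl⟩, ?_⟩
    rw [translateOrbit_orbit hstab, hi]
    refine Prod.ext rfl ?_
    refine MulAction.orbit_eq_iff.2 ⟨⟨h, hh⟩, ?_⟩
    change h • e = _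
    simp [mul_smul]
  · rintro ⟨_, ⟨t, ht, rfl⟩, rfl⟩
    rw [translateOrbit_orbit hstab]
    have hd := (ht.symm.dual hX hR hT h₀)
    rw [inv_inv] at hd
    have hd' := hg₀.dual hX hR hT hd.1
    refine ⟨⟨P'.idx, _, rfl, t⁻¹ * g₀, ?_, ?_⟩, P'.quotientOfOrbit_eq hd'.1⟩
    -- Since `t⁻¹` fixes the wall, it preserves each of its labelled sides, so the condition on `g₀`
    -- passes to `t⁻¹ * g₀`.
    · have hW : P.wall = t⁻¹ • P.wall := isTeleport_wall L hX hR hT ht.symm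
      rw [h₀.2, hW, L.side_smul, mul_smul, ← Set.smul_set_inter]
      exact hside.smul_set
    · change (t⁻¹ * g₀) • P'.triple.edgeClass _ = _
      rw [mul_smul, ← hd'.2, ← hd.2, hc.2 _ h₀]

lemma image_gluingSet (hX : X.IsCAT0) (hR : 0 ≤ R) (hT : IsStage L j T) {P : Portal j T}
    {c : X.Colouring K R k} (hc : P.IsColouring c) {e₀ : X.Edge} (h₀ : P.Dual e₀) (s : Bool) :
    quotientOfOrbit T '' gluingSet L T s e₀ c = P.compatibleQuotients L s := by
  ext q
  constructor
  · rintro ⟨_, ⟨i, e, rfl, g, hside, hg⟩, rfl⟩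
    obtain ⟨rfl, P', rfl, hd, htel⟩ := exists_portal hX hR hT hc h₀ hg
    refine ⟨P', ⟨⟨_, e, h₀, hd, g, (hc.2 _ h₀).trans hg.symm⟩, g, htel, ?_⟩,
      P'.quotientOfOrbit_eq hd⟩
    rwa [← h₀.2]
  · rintro ⟨P', ⟨-, g, htel, hside⟩, rfl⟩
    obtain ⟨hd, hcl⟩ := htel.dual hX hR hT h₀
    refine ⟨_, ⟨P'.idx, g⁻¹ • e₀, rfl, g, by rwa [h₀.2], ?_⟩, P'.quotientOfOrbit_eq hd⟩
    exact hcl.symm.trans (hc.2 _ h₀)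

end Portal

end Counting

end CubeComplex

theorem lemma9p6 {V G : Type*} [Group G] [MulAction G V] (X : CubeComplex V) [X.CubicalAction G]
    -- a proper cocompact action on a CAT(0) cube complex, preserving a labelling of sides of walls
    (hX : X.IsCAT0) (hproper : X.IsProperAction G)
    (hcocompact : CubeComplex.IsCocompactOn (⊤ : Subgroup G) (Set.univ : Set X.Point))
    (L : X.SideLabelling G)
    -- the quotient `X / K` and the graph `Γ` of its walls
    (K : Subgroup G) [K.Normal] (hK : ∀ g ∈ K, ∀ p : X.Point, g • p = p → g = 1)
    (R : ℝ) (hR : 1 < R)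
    (k : ℕ) (hk : ∀ a, ((X.wallGraph K R).neighborSet a).encard ≤ k)
    -- the finite collection `𝒱_j`
    (j : ℕ) {ι : Type*} [Finite ι] (T : ι → X.Triple K R k) (hT : CubeComplex.IsStage L j T)
    -- portals that are teleports of each other have conjugate stabilisers
    (hstab : ∀ (g : G) (P P' : CubeComplex.Portal j T), CubeComplex.Portal.IsTeleport g P P' →
      P.stab = P'.stab.map (MulAut.conj g).toMonoidHom)
    (P : CubeComplex.Portal j T) :
    (P.compatibleQuotients L true).Finite ∧ (P.compatibleQuotients L false).Finite ∧
      (P.compatibleQuotients L true).ncard = (P.compatibleQuotients L false).ncard := by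
  have hR₀ : 0 ≤ R := by linarith
  obtain ⟨c, hc⟩ := P.exists_isColouring hX hR₀ hT
  obtain ⟨e₀, h₀⟩ := P.exists_dual
  have hfin := fun s => CubeComplex.finite_gluingSet hproper hcocompact L T s e₀ c
  have himage := fun s => CubeComplex.Portal.image_gluingSet hX hR₀ hT hc h₀ s
  -- The second factor, the size of the fibres, does not involve the sign `s`.
  have hcount : ∀ s, (CubeComplex.gluingSet L T s e₀ c).ncard =
      (P.compatibleQuotients L s).ncard * (P.selfTeleportOrbits e₀).ncard := by
    intro s
    rw [← himage s]
    refine Set.ncard_eq_ncard_image_mul (hfin s) _ fun b hb => ?_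
    rw [himage s] at hb
    obtain ⟨P', ⟨-, g, htel, hside⟩, rfl⟩ := hb
    have hst := hstab g P P' htel
    rw [CubeComplex.Portal.gluingSet_fibre_eq hX hR₀ hT hc h₀ htel hst hside]
    exact (CubeComplex.Portal.injOn_translateOrbit hX hR₀ hT htel hst h₀).ncard_image
  refine ⟨himage true ▸ (hfin true).image _, himage false ▸ (hfin false).image _, ?_⟩
  have heq : (CubeComplex.gluingSet L T true e₀ c).ncard =
      (CubeComplex.gluingSet L T false e₀ c).ncard := congrArg ENat.toNat (hT.gluing e₀ c)
  -- The value 0 also stands for an infinite set of orbits. In that case the finite gluing sets have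
  -- no elements, so no portal quotient is compatible with either sign.
  rcases Nat.eq_zero_or_pos (P.selfTeleportOrbits e₀).ncard with hm | hm
  · have hempty : ∀ s, P.compatibleQuotients L s = ∅ := fun s => by
      have := hcount s
      rw [hm, mul_zero, Set.ncard_eq_zero (hfin s)] at this
      rw [← himage s, this, Set.image_empty]
    rw [hempty, hempty]
  · rw [hcount, hcount] at heq
    exact Nat.eq_of_mul_eq_mul_right hm heq
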